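/- Let $G$ be a compact Lie group with semisimple Lie algebra $\mathfrak g$, let $\langle\cdot,\cdot\rangle$ be the Killing form of $\mathfrak g$, used to identify $\mathfrak g^*$ with $\mathfrak g$, and let $G$ act on $\mathfrak g\times\mathfrak g\times\mathfrak g$ by the diagonal adjoint action. Let $U\subseteq\mathfrak g\times\mathfrak g\times\mathfrak g$ be an open subset invariant under $G$ and under $(a,b,c)\mapsto(a,b,c)O$ for $O\in SO(3)$ (for instance the whole space), and let $A:U\to S^2(\mathfrak g)$ be a smooth $SO(3)$-invariant function, viewed as a family of symmetric bilinear forms $A_{\xi,\eta}$ on $\mathfrak g$; define $A^{\#}u\in\mathfrak g$ by $\langle A^{\#}u,\eta\rangle=A_{u,\eta}$. With $l^1_\xi(a,b,c)=\langle\xi,a\rangle$, $l^2_\xi(a,b,c)=\langle\xi,b\rangle$, $l^3_\xi(a,b,c)=\langle\xi,c\rangle$, let $\pi$ be the bivector field on $U$ with brackets $$\{l^1_\xi,l^1_\eta\}=l^1_{[\xi,\eta]},\quad \{l^1_\xi,l^i_\eta\}=\{l^i_\xi,l^1_\eta\}=l^i_{[\xi,\eta]},\quad \{l^i_\xi,l^i_\eta\}=-l^1_{[\xi,\eta]}\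 (i=2,3),\quad \{l^2_\xi,l^3_\eta\}=-\{l^3_\xi,l^2_\eta\}=A_{\xi,\eta},$$ and let $X_f=\pi^{\#}(df)$. Assume that (i) $A$ is $G$-equivariant, and at every $(a,b,c)\in U$, for all $\xi,\eta\in\mathfrak g$, $\ \xi\lrcorner X_{l^2_\eta}A-\eta\lrcorner X_{l^2_\xi}A=[c,[\xi,\eta]]$ and $\ \xi\lrcorner X_{l^3_\eta}A-\eta\lrcorner X_{l^3_\xi}A=[b,[\eta,\xi]]$; (ii) for every $(a,b,c)\in U$ and $\xi\in\mathfrak g$ there are $u,v,w\in\mathfrak g$ with $A^{\#}u+[v,c]-[w,b]=[\xi,a]$, $\ -[u,c]+A^{\#}v+[w,a]=[\xi,b]$, $\ [u,b]-[v,a]+A^{\#}w=[\xi,c]$, $\ -[u,a]-[v,b]-[w,c]=A^{\#}\xi$. Let $V$ be a three-dimensional Euclidean space (for instance $\mathfrak{su}(2)$ with minus its Killing form), let $\mathcal F=(e_1,e_2,e_3)$ be an orthonormal basis of $V$, let $\Psi_{\mathcal F}:L(\mathfrak g,V)\to\mathfrak g\times\mathfrak g\times\mathfrak g$ be the identification $a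 e_1+b e_2+c e_3\mapsto(a,b,c)$, and let $\pi_1,\pi_2,\pi_3$ be the pull-backs of $\pi$ to $M_U\subseteq L(\mathfrak g,V)$, the set of points that the identification maps into $U$, under the identifications given by $(e_1,e_2,e_3)$, $(e_2,e_3,e_1)$, $(e_3,e_1,e_2)$. Let $S\subseteq M_U$ be a symplectic leaf of $\pi_1=\pi_{\mathcal F}$. Then each of $\pi_1,\pi_2,\pi_3$ induces a nondegenerate form, $\omega_1,\omega_2,\omega_3$ respectively, on the tangent spaces $T_xS=\pi_1^{\#}(T_x^*M)$, the inverse of $\pi_i^{\#}$, and $g=\omega_3^{b}(\omega_1^{b})^{-1}\omega_2^{b}:TS\to T^*S$ is symmetric and nondegenerate (the pseudo-metric of the leaf). Moreover: (1) $g$ is $G$-invariant: for the action of $G$ on $L(\mathfrak g,V)$ induced by the adjoint action, each $k\in G$ maps $S$ onto a symplectic leaf, which is $S$ itself if $k$ lies in the identity component of $G$; and $k$ maps the tangent spaces of $S$ onto those of $kS$ and carries the pseudo-metric of $S$ to that of $kS$. (2) For all $\xi\in\mathfrak g$, the infinitesimal generator $\hat\xi=([\xi,a],[\xi,b],[\xi,c])$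 of the action is tangent to $S$ and $g(\hat\xi,\hat\xi)=-A_{\xi,\xi}$ on $S$. -/

import Mathlib

open scoped Manifold ContDiff

noncomputable section

namespace HyperLiePoisson

/-! ### Smooth functions, bivectors and symplectic leaves on a finite-dimensional real vector space

A finite-dimensional real vector space carries its standard smooth structure, given by linear
coordinates. -/

section VectorSpace

variable {W : Type*} [AddCommGroup W] [Module ℝ W] [Module.Finite ℝ W]

variable (W) in
/-- Linear coordinates on a finite-dimensional real vector space. -/
def coord : W ≃ₗ[ℝ] (Fin (Module.finrank ℝ W) → ℝ) :=
  (Module.finBasis ℝ W).equivFun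

/-- Open subsets, for the standard topology of a finite-dimensional real vector space. -/
def IsOpenSet (D : Set W) : Prop :=
  IsOpen ((coord W).symm ⁻¹' D)

/-- Smooth (`C^∞`) real-valued functions on `D`. -/
def SmoothOn (f : W → ℝ) (D : Set W) : Prop :=
  ContDiffOn ℝ ∞ (fun y => f ((coord W).symm y)) ((coord W).symm ⁻¹' D)

/-- The differential `df` at the point `x`, a covector. -/
def differential (f : W → ℝ) (x : W) : Module.Dual ℝ W :=
  (fderiv ℝ (fun y => f ((coord W).symm y)) (coord W x)).toLinearMap ∘ₗ (coord W).toLinearMap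

variable (W) in
/-- A contravariant two-tensor at a point of `W`, as a bilinear form `(α, β) ↦ π(α, β)` on
covectors. -/
abbrev BiTensor : Type _ := Module.Dual ℝ W →ₗ[ℝ] Module.Dual ℝ W →ₗ[ℝ] ℝ

/-- The bundle map `π^♯ : T^*W → TW`, characterized by `⟨π^♯ α, β⟩ = π(α, β)`. -/
def sharp (π : BiTensor W) : Module.Dual ℝ W →ₗ[ℝ] W :=
  (Module.evalEquiv ℝ W).symm.toLinearMap ∘ₗ π

theorem apply_sharp (π : BiTensor W) (α β : Module.Dual ℝ W) : β (sharp π α) = π α β := by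
  simp [sharp]

/-- The hamiltonian vector field `X_f = π^♯(df)`; thus `{f, g} = X_f g = π(df, dg)`. -/
def hamiltonianField (π : W → BiTensor W) (f : W → ℝ) (x : W) : W :=
  sharp (π x) (differential f x)

/-- `y` is reached from `x` along an integral curve, contained in `D`, of the hamiltonian vector
field of a smooth function on `D`. -/
def HamiltonianStep (π : W → BiTensor W) (D : Set W) (x y : W) : Prop :=
  ∃ (f : W → ℝ) (γ : ℝ → W), SmoothOn f D ∧ γ 0 = x ∧ γ 1 = y ∧
    ∀ t ∈ Set.Icc (0 : ℝ) 1, γ t ∈ D ∧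
      ∀ β : Module.Dual ℝ W,
        HasDerivWithinAt (fun s => β (γ s)) (β (hamiltonianField π f (γ t))) (Set.Icc 0 1) t

/-- The symplectic leaf through `x` of the tensor field `π` on `D`: the points that can be joined
to `x` by a piecewise smooth curve each of whose pieces is an integral curve of a hamiltonian
vector field. -/
def leafThrough (π : W → BiTensor W) (D : Set W) (x : W) : Set W :=
  {y | Relation.ReflTransGen (HamiltonianStep π D) x y}

/-- `S` is a symplectic leaf of `π` on `D`. -/
def IsSymplecticLeaf (π : W → BiTensor W) (D S : Set W) : Prop :=
  ∃ x ∈ D, S = leafThrough π D x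

/-- The tangent space at a point of the symplectic leaf through that point: the characteristic
space `π^♯(T^*W)`, i.e. the space of values of hamiltonian vector fields. -/
def leafTangent (π : BiTensor W) : Submodule ℝ W := LinearMap.range (sharp π)

/-- `Ω : T → T^*` is the bundle map `v ↦ Ω(v, ·)` of the symplectic form that `π` induces on the
tangent space `T` of its leaf: `T` is the characteristic space of `π`, and `Ω` is the inverse of
`π^♯`, i.e. `Ω(π^♯ α, w) = ⟨α, w⟩`. -/
def IsInducedForm (π : BiTensor W) (T : Submodule ℝ W) (Ω : T ≃ₗ[ℝ] Module.Dual ℝ T) : Prop :=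
  leafTangent π = T ∧
    ∀ (α : Module.Dual ℝ W) (v w : T), sharp π α = (v : W) → Ω v w = α (w : W)

/-- `g : T → T^*` is the pseudo-metric `g = Ω₃ ∘ Ω₁⁻¹ ∘ Ω₂` of the three symplectic forms that
`π 0, π 1, π 2` induce on `T`. -/
def IsPseudoMetric (π : Fin 3 → BiTensor W) (T : Submodule ℝ W)
    (g : T →ₗ[ℝ] Module.Dual ℝ T) : Prop :=
  ∃ Ω : Fin 3 → (T ≃ₗ[ℝ] Module.Dual ℝ T), (∀ i, IsInducedForm (π i) T (Ω i)) ∧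
    g = (Ω 2).toLinearMap ∘ₗ (Ω 0).symm.toLinearMap ∘ₗ (Ω 1).toLinearMap

end VectorSpace

/-! ### The tensor `π` on `𝔤 × 𝔤 × 𝔤` -/

section LieAlg

variable {𝔤 : Type*} [LieRing 𝔤] [LieAlgebra ℝ 𝔤] [Module.Finite ℝ 𝔤] [LieAlgebra.IsKilling ℝ 𝔤]

variable (𝔤) in
/-- The identification `𝔤 ≃ 𝔤^*`, `ξ ↦ ⟨ξ, ·⟩`, through the Killing form. -/
def killingDual : 𝔤 ≃ₗ[ℝ] Module.Dual ℝ 𝔤 :=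
  LinearMap.BilinForm.toDual (killingForm ℝ 𝔤)
    (LieAlgebra.IsKilling.killingForm_nondegenerate ℝ 𝔤)


/-- The bilinear form `(ξ, η) ↦ ⟨[ξ, η], c⟩`. -/
def lieForm (c : 𝔤) : LinearMap.BilinForm ℝ 𝔤 :=
  LinearMap.mk₂ ℝ (fun ξ η => killingForm ℝ 𝔤 ⁅ξ, η⁆ c)
    (fun _ _ _ => by rw [add_lie, map_add, LinearMap.add_apply])
    (fun _ _ _ => by rw [smul_lie, map_smul, LinearMap.smul_apply])
    (fun _ _ _ => by rw [lie_add, map_add, LinearMap.add_apply])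
    (fun _ _ _ => by rw [lie_smul, map_smul, LinearMap.smul_apply])

/-- The linear function `l^i_ξ (x₁, x₂, x₃) = ⟨ξ, x_i⟩`. -/
def linFun (i : Fin 3) (ξ : 𝔤) : Module.Dual ℝ (Fin 3 → 𝔤) :=
  killingDual 𝔤 ξ ∘ₗ LinearMap.proj i

/-- The covector `α` on `𝔤 × 𝔤 × 𝔤` is `∑ i, l^i_{u_i}` with `u_i = covectorComp α i`. -/
def covectorComp (i : Fin 3) : Module.Dual ℝ (Fin 3 → 𝔤) →ₗ[ℝ] 𝔤 :=
  (killingDual 𝔤).symm.toLinearMap ∘ₗ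
    (LinearMap.single ℝ (fun _ : Fin 3 => 𝔤) i).dualMap

/-- The table of the brackets `{l^i_ξ, l^j_η}` at the point `x = (a, b, c)`, where `A` is the value
at `x` of the `S²(𝔤)`-valued function, as the bilinear form `(ξ, η) ↦ A_{ξ, η}`. -/
def bracketTable (A : LinearMap.BilinForm ℝ 𝔤) (x : Fin 3 → 𝔤) :
    Fin 3 → Fin 3 → LinearMap.BilinForm ℝ 𝔤 :=
  ![![lieForm (x 0),  lieForm (x 1),  lieForm (x 2)],
    ![lieForm (x 1), -lieForm (x 0),             A],
    ![lieForm (x 2),            -A, -lieForm (x 0)]]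

/-- The bivector field `π` on `𝔤 × 𝔤 × 𝔤` with the above brackets of linear functions. -/
def tensor (A : (Fin 3 → 𝔤) → LinearMap.BilinForm ℝ 𝔤) (x : Fin 3 → 𝔤) :
    BiTensor (Fin 3 → 𝔤) :=
  ∑ i : Fin 3, ∑ j : Fin 3,
    (bracketTable (A x) x i j).compl₁₂ (covectorComp i) (covectorComp j)

theorem covectorComp_linFun (i j : Fin 3) (ξ : 𝔤) :
    covectorComp j (linFun i ξ) = if i = j then ξ else 0 := by
  have h : (LinearMap.single ℝ (fun _ : Fin 3 => 𝔤) j).dualMap (linFun i ξ)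
      = killingDual 𝔤 (if i = j then ξ else 0) := by
    ext η
    by_cases hij : i = j
    · subst hij; simp [linFun]
    · simp [linFun, hij]
  simp only [covectorComp, LinearMap.comp_apply, h, LinearEquiv.coe_coe,
    LinearEquiv.symm_apply_apply]

/-- The brackets of linear functions are those of the table. -/
theorem tensor_linFun (A : (Fin 3 → 𝔤) → LinearMap.BilinForm ℝ 𝔤) (x : Fin 3 → 𝔤)
    (i j : Fin 3) (ξ η : 𝔤) :
    tensor A x (linFun i ξ) (linFun j η) = bracketTable (A x) x i j ξ η := by
  simp only [tensor, LinearMap.sum_apply, LinearMap.compl₁₂_apply, covectorComp_linFun]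
  rw [Finset.sum_eq_single i, Finset.sum_eq_single j]
  · simp
  · intro k _ hk; simp [hk.symm]
  · simp
  · intro k _ hk; simp [hk.symm]
  · simp

/-- `A^♯ u`, the contraction of `A` with `u`, as an element of `𝔤`: `⟨A^♯ u, η⟩ = A_{u, η}`. -/
def contract (A : LinearMap.BilinForm ℝ 𝔤) (u : 𝔤) : 𝔤 := (killingDual 𝔤).symm (A u)

/-- `X_{l^i_η}(A_{ξ, ζ})` at `x`: the derivative of the function `A_{ξ, ζ}` along the hamiltonian
vector field of `l^i_η`. -/
def derivAlong (A : (Fin 3 → 𝔤) → LinearMap.BilinForm ℝ 𝔤) (i : Fin 3) (η ξ ζ : 𝔤)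
    (x : Fin 3 → 𝔤) : ℝ :=
  differential (fun y => A y ξ ζ) x (hamiltonianField (tensor A) (fun y => linFun i η y) x)

/-- The two first order equations
`ξ ⌟ X_{l²_η} A - η ⌟ X_{l²_ξ} A = [c, [ξ, η]]`, `ξ ⌟ X_{l³_η} A - η ⌟ X_{l³_ξ} A = [b, [η, ξ]]`
at `x = (a, b, c)`, between elements of `𝔤`, paired with all `ζ ∈ 𝔤` under the Killing form. -/
def JacobiEquations (A : (Fin 3 → 𝔤) → LinearMap.BilinForm ℝ 𝔤) (x : Fin 3 → 𝔤) : Prop :=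
  ∀ ξ η ζ : 𝔤,
    derivAlong A 1 η ξ ζ x - derivAlong A 1 ξ η ζ x = killingForm ℝ 𝔤 ⁅x 2, ⁅ξ, η⁆⁆ ζ ∧
    derivAlong A 2 η ξ ζ x - derivAlong A 2 ξ η ζ x = killingForm ℝ 𝔤 ⁅x 1, ⁅η, ξ⁆⁆ ζ

/-- Solvability at `x = (a, b, c)`, for every `ξ`, of the linear system for `(u, v, w)`. -/
def SystemSolvable (A : LinearMap.BilinForm ℝ 𝔤) (x : Fin 3 → 𝔤) : Prop :=
  ∀ ξ : 𝔤, ∃ u v w : 𝔤,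
    contract A u + ⁅v, x 2⁆ - ⁅w, x 1⁆ = ⁅ξ, x 0⁆ ∧
    -⁅u, x 2⁆ + contract A v + ⁅w, x 0⁆ = ⁅ξ, x 1⁆ ∧
    ⁅u, x 1⁆ - ⁅v, x 0⁆ + contract A w = ⁅ξ, x 2⁆ ∧
    -⁅u, x 0⁆ - ⁅v, x 1⁆ - ⁅w, x 2⁆ = contract A ξ

/-- The right action `(a, b, c) ↦ (a, b, c) O` of `3 × 3` matrices. -/
def rotate (O : Matrix (Fin 3) (Fin 3) ℝ) (x : Fin 3 → 𝔤) : Fin 3 → 𝔤 :=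
  fun j => ∑ i, O i j • x i

/-! ### The space `M = L(𝔤, V)`, `V` a three-dimensional Euclidean space such as `𝔰𝔲(2)` -/

section Frames

variable {V : Type*} [NormedAddCommGroup V] [InnerProductSpace ℝ V]

/-- The identification `Ψ_F : L(𝔤, V) → 𝔤 × 𝔤 × 𝔤` given by a frame `F = (e₁, e₂, e₃)`:
`φ = a e₁ + b e₂ + c e₃`, where `a, b, c ∈ 𝔤^* ≃ 𝔤`. -/
def frameIdent (F : OrthonormalBasis (Fin 3) ℝ V) : (𝔤 →ₗ[ℝ] V) ≃ₗ[ℝ] (Fin 3 → 𝔤) where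
  toFun φ := fun i => (killingDual 𝔤).symm ((innerₛₗ ℝ (F i)) ∘ₗ φ)
  invFun x := ∑ i, (killingDual 𝔤 (x i)).smulRight (F i)
  map_add' φ ψ := by
    funext i; simp [LinearMap.comp_add]
  map_smul' r φ := by
    funext i; simp [LinearMap.comp_smul]
  left_inv φ := by
    ext ξ
    simp [F.sum_repr']
  right_inv x := by
    funext i
    rw [LinearEquiv.symm_apply_eq]
    ext ξ
    simp [inner_sum, inner_smul_right, F.inner_eq_ite]

/-- The cyclic permutations of a frame: `F`, `(e₂, e₃, e₁)`, `(e₃, e₁, e₂)` for `k = 0, 1, 2`. -/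
def cyclicFrame (F : OrthonormalBasis (Fin 3) ℝ V) (k : Fin 3) : OrthonormalBasis (Fin 3) ℝ V :=
  F.reindex (Equiv.subRight k)

theorem cyclicFrame_apply (F : OrthonormalBasis (Fin 3) ℝ V) (k j : Fin 3) :
    cyclicFrame F k j = F (j + k) := by
  simp [cyclicFrame]

/-- The tensor field `π_F` on `M = L(𝔤, V)`, the pull-back of `π` under `Ψ_F`. -/
def frameTensor (A : (Fin 3 → 𝔤) → LinearMap.BilinForm ℝ 𝔤) (F : OrthonormalBasis (Fin 3) ℝ V)
    (φ : 𝔤 →ₗ[ℝ] V) : BiTensor (𝔤 →ₗ[ℝ] V) :=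
  (tensor A (frameIdent F φ)).compl₁₂ (frameIdent F).symm.dualMap.toLinearMap
    (frameIdent F).symm.dualMap.toLinearMap

/-- The infinitesimal generator `ξ̂` of the action `(k • φ)(η) = φ(Ad_{k⁻¹} η)` on `M = L(𝔤, V)`:
the vector field `φ ↦ d/dt|₀ (exp(tξ) • φ) = -φ ∘ ad ξ`. -/
def generator (ξ : 𝔤) (φ : 𝔤 →ₗ[ℝ] V) : 𝔤 →ₗ[ℝ] V :=
  -(φ ∘ₗ (LieAlgebra.ad ℝ 𝔤 ξ : 𝔤 →ₗ[ℝ] 𝔤))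

/-- On `𝔤 × 𝔤 × 𝔤` the generator is `ξ̂ (a, b, c) = ([ξ, a], [ξ, b], [ξ, c])`. -/
theorem frameIdent_generator (F : OrthonormalBasis (Fin 3) ℝ V) (ξ : 𝔤) (φ : 𝔤 →ₗ[ℝ] V)
    (i : Fin 3) : frameIdent F (generator ξ φ) i = ⁅ξ, frameIdent F φ i⁆ := by
  have h : ∀ η, killingForm ℝ 𝔤 (frameIdent F φ i) η = inner ℝ (F i) (φ η) := by
    intro η
    have : killingDual 𝔤 (frameIdent F φ i) = (innerₛₗ ℝ (F i)) ∘ₗ φ := by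
      simp [frameIdent]
    exact LinearMap.congr_fun this η
  apply (killingDual 𝔤).injective
  ext η
  have h2 : killingDual 𝔤 (frameIdent F (generator ξ φ) i)
      = (innerₛₗ ℝ (F i)) ∘ₗ (generator ξ φ) := by
    simp [frameIdent]
  rw [h2]
  change inner ℝ (F i) (-(φ ⁅ξ, η⁆)) = killingForm ℝ 𝔤 ⁅ξ, frameIdent F φ i⁆ η
  rw [inner_neg_right, ← h, ← map_neg, lie_skew]
  change LieModule.traceForm ℝ 𝔤 𝔤 _ _ = LieModule.traceForm ℝ 𝔤 𝔤 _ _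
  rw [← LieModule.traceForm_apply_lie_apply, LieModule.traceForm_comm,
    ← LieModule.traceForm_apply_lie_apply]

end Frames

end LieAlg

/-! ### The adjoint action of the Lie group -/

section Group

variable {n : ℕ} {G : Type*} [TopologicalSpace G] [ChartedSpace (EuclideanSpace ℝ (Fin n)) G]
  [Group G]

instance [LieGroup (𝓡 n) ∞ G] : LieGroup (𝓡 n) (minSmoothness ℝ 3) G :=
  LieGroup.of_le (n := ∞) (by simpa using ENat.LEInfty.out (m := (3 : WithTop ℕ∞)))

instance : Module.Finite ℝ (GroupLieAlgebra (𝓡 n) G) :=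
  inferInstanceAs (Module.Finite ℝ (EuclideanSpace ℝ (Fin n)))

/-- The adjoint action of `k ∈ G` on the Lie algebra: the derivative at `1` of conjugation. -/
def Ad (k : G) : GroupLieAlgebra (𝓡 n) G →ₗ[ℝ] GroupLieAlgebra (𝓡 n) G :=
  (show EuclideanSpace ℝ (Fin n) →L[ℝ] EuclideanSpace ℝ (Fin n) from
    mfderiv (𝓡 n) (𝓡 n) (fun h : G => k * h * k⁻¹) 1).toLinearMap

/-- The diagonal adjoint action on `𝔤 × 𝔤 × 𝔤`. -/
def diagAd (k : G) (x : Fin 3 → GroupLieAlgebra (𝓡 n) G) : Fin 3 → GroupLieAlgebra (𝓡 n) G :=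
  fun i => Ad k (x i)

/-- The induced action on `M = L(𝔤, V)`, `(k • φ)(ξ) = φ(Ad_{k⁻¹} ξ)`. -/
def actM {V : Type*} [AddCommGroup V] [Module ℝ V] (k : G)
    (φ : GroupLieAlgebra (𝓡 n) G →ₗ[ℝ] V) : GroupLieAlgebra (𝓡 n) G →ₗ[ℝ] V :=
  φ ∘ₗ Ad k⁻¹

end Group

end HyperLiePoisson

end

open HyperLiePoisson

/-! Write a covector on `L(𝔤, V)` as a triple `u` in `𝔤³` and send it to `q = quat A x u` in `𝔤⁴ = 𝔤
⊗ ℍ`. The three bundle maps `π₁^♯, π₂^♯, π₃^♯` are then `Im(iq)`, `Im(jq)`, `Im(kq)`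
(`frameIdent_sharp_cyclicFrame`). Solvability of the linear system says that `(A^♯ ξ, [ξ,a], [ξ,b],
[ξ,c])` lies in the range of `quat`, and this makes the range stable under `i, j, k`. Hence the
three tensors have the same characteristic space, the imaginary part of that range, and each of
them, being skew, inverts there to a nondegenerate form.

Since `ij = k`, the composite `π₂^♯ (π₃^♯)⁻¹ π₁^♯` is represented by `u ↦ Im (quat u)`, which is
symmetric for the Killing form; this gives the symmetry of `g`. The generator `ξ̂` has explicit
potentials for `π₂` and `π₃`, and skewness reduces `g(ξ̂, ξ̂)` to a single entry of `π₁`, namely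
`-A_{ξ,ξ}`.

For the group, `Ad k` is a Lie algebra automorphism, so it preserves the Killing form and, by
equivariance of `A`, all three tensors; it therefore permutes leaves and carries pseudo-metrics to
pseudo-metrics. For the identity component no exponential map of `G` is needed: when `k` is near
`1`, `Ad k` is an automorphism near the identity, its logarithm is a derivation, and derivations are
inner, so `Ad k = exp (ad ξ)`. As `ξ̂` is hamiltonian for a linear function, `k` moves a point
within its leaf. The stabilizer of a leaf is thus an open subgroup, hence closed, and contains the
identity component. -/

namespace HyperLiePoisson

/-! ### Linear algebra of three skew tensors with a common characteristic space. -/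

section PseudoMetric

variable {W : Type*} [AddCommGroup W] [Module ℝ W] [Module.Finite ℝ W]

theorem sharp_mem_leafTangent (π : BiTensor W) (α : Module.Dual ℝ W) :
    sharp π α ∈ leafTangent π :=
  LinearMap.mem_range_self _ _

theorem eq_of_forall_dual {v w : W} (h : ∀ β : Module.Dual ℝ W, β v = β w) : v = w := by
  rw [← sub_eq_zero, ← Module.forall_dual_apply_eq_zero_iff ℝ]
  intro β
  rw [map_sub, h, sub_self]

theorem ker_sharp_eq_dualAnnihilator {π : BiTensor W} (hπ : ∀ α β, π α β = -π β α) :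
    LinearMap.ker (sharp π) = (leafTangent π).dualAnnihilator := by
  ext α
  rw [LinearMap.mem_ker, Submodule.mem_dualAnnihilator]
  constructor
  · rintro h _ ⟨β, rfl⟩
    rw [apply_sharp, hπ, ← apply_sharp, h, map_zero, neg_zero]
  · intro h
    refine eq_of_forall_dual fun β => ?_
    rw [apply_sharp, hπ, ← apply_sharp, h _ (sharp_mem_leafTangent π β), map_zero, neg_zero]

/-- A skew tensor induces a form on its characteristic space. -/
theorem exists_isInducedForm {π : BiTensor W} (hπ : ∀ α β, π α β = -π β α) {T : Submodule ℝ W}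
    (hT : leafTangent π = T) : ∃ Ω : T ≃ₗ[ℝ] Module.Dual ℝ T, IsInducedForm π T Ω := by
  subst hT
  let s : Module.Dual ℝ W →ₗ[ℝ] leafTangent π := (sharp π).rangeRestrict
  have hs : Function.Surjective s := LinearMap.surjective_rangeRestrict _
  let r : Module.Dual ℝ W →ₗ[ℝ] Module.Dual ℝ (leafTangent π) := (leafTangent π).dualRestrict
  have hr : Function.Surjective r := Subspace.dualRestrict_surjective
  have hk : LinearMap.ker s = LinearMap.ker r := by
    rw [show LinearMap.ker s = LinearMap.ker (sharp π) from LinearMap.ker_rangeRestrict _,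
      ker_sharp_eq_dualAnnihilator hπ,
      ← Submodule.dualRestrict_ker_eq_dualAnnihilator]
  let Ω := (s.quotKerEquivOfSurjective hs).symm ≪≫ₗ Submodule.quotEquivOfEq _ _ hk ≪≫ₗ
    r.quotKerEquivOfSurjective hr
  refine ⟨Ω, rfl, fun α v w h => ?_⟩
  have hv : v = s α := Subtype.ext h.symm
  have h1 : (s.quotKerEquivOfSurjective hs).symm v = Submodule.Quotient.mk α := by
    rw [LinearEquiv.symm_apply_eq, hv]
    rfl
  have h2 : Ω v = r α := by
    simp only [Ω, LinearEquiv.trans_apply, h1, Submodule.quotEquivOfEq_mk]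
    rfl
  rw [h2]
  rfl

/-- `Ω 1` turns `v` into `α` restricted to `T`, the inverse of `Ω 0` turns that into `π₀^♯ α = π₂^♯
β`, and `Ω 2` returns `β`. Every later computation of `g` goes through such a pair of covectors. -/
theorem IsPseudoMetric.apply_eq {π : Fin 3 → BiTensor W} {T : Submodule ℝ W}
    {g : T →ₗ[ℝ] Module.Dual ℝ T} (hg : IsPseudoMetric π T g) {α β : Module.Dual ℝ W} {v : T}
    (hv : sharp (π 1) α = v) (hβ : sharp (π 2) β = sharp (π 0) α) (w : T) :
    g v w = β w := by
  obtain ⟨Ω, hΩ, rfl⟩ := hg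
  let z : T := ⟨sharp (π 0) α, (hΩ 0).1 ▸ sharp_mem_leafTangent _ _⟩
  have hz : (Ω 0).symm (Ω 1 v) = z := by
    rw [LinearEquiv.symm_apply_eq]
    ext w
    rw [(hΩ 0).2 α z w rfl, (hΩ 1).2 α v w hv]
  change Ω 2 ((Ω 0).symm (Ω 1 v)) w = β w
  rw [hz, (hΩ 2).2 β z w hβ]

theorem IsPseudoMetric.exists_covectors {π : Fin 3 → BiTensor W} {T : Submodule ℝ W}
    (hT : ∀ i, leafTangent (π i) = T) (v : T) :
    ∃ α β, sharp (π 1) α = v ∧ sharp (π 2) β = sharp (π 0) α := by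
  obtain ⟨α, hα⟩ : (v : W) ∈ leafTangent (π 1) := by rw [hT]; exact v.2
  obtain ⟨β, hβ⟩ : sharp (π 0) α ∈ leafTangent (π 2) := by
    rw [hT, ← hT 0]; exact sharp_mem_leafTangent _ _
  exact ⟨α, β, hα, hβ⟩

theorem IsPseudoMetric.leafTangent_eq {π : Fin 3 → BiTensor W} {T : Submodule ℝ W}
    {g : T →ₗ[ℝ] Module.Dual ℝ T} (hg : IsPseudoMetric π T g) (i : Fin 3) :
    leafTangent (π i) = T := by
  obtain ⟨Ω, hΩ, -⟩ := hg
  exact (hΩ i).1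

theorem IsPseudoMetric.bijective {π : Fin 3 → BiTensor W} {T : Submodule ℝ W}
    {g : T →ₗ[ℝ] Module.Dual ℝ T} (hg : IsPseudoMetric π T g) : Function.Bijective g := by
  obtain ⟨Ω, -, rfl⟩ := hg
  exact ((Ω 1).trans ((Ω 0).symm.trans (Ω 2))).bijective

theorem IsPseudoMetric.unique {π : Fin 3 → BiTensor W} {T : Submodule ℝ W}
    {g g' : T →ₗ[ℝ] Module.Dual ℝ T} (hg : IsPseudoMetric π T g) (hg' : IsPseudoMetric π T g') :
    g = g' := by
  ext v w
  obtain ⟨α, β, hv, hβ⟩ := IsPseudoMetric.exists_covectors hg.leafTangent_eq v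
  rw [hg.apply_eq hv hβ, hg'.apply_eq hv hβ]

theorem existsUnique_isPseudoMetric {π : Fin 3 → BiTensor W} {T : Submodule ℝ W}
    (hπ : ∀ i α β, π i α β = -π i β α) (hT : ∀ i, leafTangent (π i) = T) :
    ∃! g : T →ₗ[ℝ] Module.Dual ℝ T, IsPseudoMetric π T g := by
  choose Ω hΩ using fun i => exists_isInducedForm (hπ i) (hT i)
  have h : IsPseudoMetric π T
      ((Ω 2).toLinearMap ∘ₗ (Ω 0).symm.toLinearMap ∘ₗ (Ω 1).toLinearMap) := ⟨Ω, hΩ, rfl⟩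
  exact ⟨_, h, fun g hg => hg.unique h⟩

/-- The pseudo-metric is symmetric as soon as `π₁ ∘ π₂⁻¹ ∘ π₀` is represented by a symmetric
map `s` from covectors to vectors. -/
theorem IsPseudoMetric.symm {π : Fin 3 → BiTensor W} {T : Submodule ℝ W}
    {g : T →ₗ[ℝ] Module.Dual ℝ T} (hg : IsPseudoMetric π T g)
    (hπ : ∀ i α β, π i α β = -π i β α) {s : Module.Dual ℝ W → W} 
    (hs : ∀ α β : Module.Dual ℝ W, β (s α) = α (s β))
    (hsπ : ∀ α, ∃ β, sharp (π 2) β = sharp (π 0) α ∧ sharp (π 1) β = s α) (v w : T) :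
    g v w = g w v := by
  have key : ∀ v w : T, ∀ α α', sharp (π 1) α = v → sharp (π 1) α' = w → g v w = -α' (s α) := by
    intro v w α α' hv hw
    obtain ⟨β, h2, h1⟩ := hsπ α
    rw [hg.apply_eq hv h2, ← hw, apply_sharp, hπ, ← apply_sharp, h1]
  obtain ⟨α, -, hv, -⟩ := IsPseudoMetric.exists_covectors hg.leafTangent_eq v
  obtain ⟨α', -, hw, -⟩ := IsPseudoMetric.exists_covectors hg.leafTangent_eq w
  rw [key v w α α' hv hw, key w v α' α hw hv, hs]

end PseudoMetric


/-! ### Quaternion units acting on `𝔤⁴`. -/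

section Quaternions

variable {𝔤 : Type*} [AddCommGroup 𝔤]

/-- Multiplication by the first imaginary quaternion. -/
def quatI (q : Fin 4 → 𝔤) : Fin 4 → 𝔤 := ![-q 1, q 0, -q 3, q 2]

/-- Multiplication by the second imaginary quaternion. -/
def quatJ (q : Fin 4 → 𝔤) : Fin 4 → 𝔤 := ![-q 2, q 3, q 0, -q 1]

/-- Multiplication by the third imaginary quaternion. -/
def quatK (q : Fin 4 → 𝔤) : Fin 4 → 𝔤 := ![-q 3, -q 2, q 1, q 0]

/-- The imaginary part of a quaternion. -/
def quatIm (q : Fin 4 → 𝔤) : Fin 3 → 𝔤 := ![q 1, q 2, q 3]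

/-- Multiplication by the `i`-th imaginary quaternion. -/
def quatUnit (i : Fin 3) : (Fin 4 → 𝔤) → Fin 4 → 𝔤 := ![quatI, quatJ, quatK] i

theorem quatUnit_iterate (i : Fin 3) (q : Fin 4 → 𝔤) :
    quatUnit i (quatUnit i (quatUnit i (quatUnit i q))) = q := by
  ext j
  fin_cases i <;> fin_cases j <;> simp [quatUnit, quatI, quatJ, quatK]

end Quaternions

/-! ### The quaternionic form of the tensor on `𝔤³`. -/

section Quaternionic

variable {𝔤 : Type*} [LieRing 𝔤] [LieAlgebra ℝ 𝔤]

theorem killingForm_comm (ξ η : 𝔤) : killingForm ℝ 𝔤 ξ η = killingForm ℝ 𝔤 η ξ :=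
  LieModule.traceForm_comm ℝ 𝔤 𝔤 ξ η

theorem killingForm_lie_left (ξ η ζ : 𝔤) :
    killingForm ℝ 𝔤 ⁅ξ, η⁆ ζ = killingForm ℝ 𝔤 ξ ⁅η, ζ⁆ :=
  LieModule.traceForm_apply_lie_apply ℝ 𝔤 𝔤 ξ η ζ

theorem killingForm_lie_swap (ξ η ζ : 𝔤) :
    killingForm ℝ 𝔤 ⁅ξ, η⁆ ζ = -killingForm ℝ 𝔤 ⁅ξ, ζ⁆ η := by
  rw [killingForm_lie_left, ← lie_skew, map_neg, ← killingForm_lie_left]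

/-- Cyclic permutations of the three arguments are given by elements of `SO(3)`. -/
theorem exists_rotate_eq_cyclic (k : Fin 3) :
    ∃ O ∈ Matrix.specialOrthogonalGroup (Fin 3) ℝ,
      ∀ x : Fin 3 → 𝔤, rotate O x = fun j => x (j + k) := by
  refine ⟨Matrix.of fun i j => if i = j + k then 1 else 0, ?_, fun x => ?_⟩
  · rw [Matrix.mem_specialOrthogonalGroup_iff, Matrix.mem_orthogonalGroup_iff]
    constructor
    · ext i j
      fin_cases k <;> fin_cases i <;> fin_cases j <;>
        simp [Matrix.mul_apply, Fin.sum_univ_three]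
    · rw [Matrix.det_fin_three]
      fin_cases k <;> simp
  · ext j
    simp [rotate]

variable [Module.Finite ℝ 𝔤] [LieAlgebra.IsKilling ℝ 𝔤]

theorem killingDual_apply (ξ η : 𝔤) : killingDual 𝔤 ξ η = killingForm ℝ 𝔤 ξ η := rfl

theorem eq_of_forall_killingForm {ξ η : 𝔤}
    (h : ∀ ζ, killingForm ℝ 𝔤 ξ ζ = killingForm ℝ 𝔤 η ζ) : ξ = η :=
  (killingDual 𝔤).injective (LinearMap.ext h)

theorem killingForm_contract (A : LinearMap.BilinForm ℝ 𝔤) (u η : 𝔤) :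
    killingForm ℝ 𝔤 (contract A u) η = A u η := by
  rw [← killingDual_apply, contract, LinearEquiv.apply_symm_apply]

@[simp] theorem contract_add (A : LinearMap.BilinForm ℝ 𝔤) (u v : 𝔤) :
    contract A (u + v) = contract A u + contract A v := by simp [contract]

@[simp] theorem contract_neg (A : LinearMap.BilinForm ℝ 𝔤) (u : 𝔤) :
    contract A (-u) = -contract A u := by simp [contract]

@[simp] theorem contract_zero (A : LinearMap.BilinForm ℝ 𝔤) :
    contract A 0 = 0 := by simp [contract]

/-- The map `𝔤³ → 𝔤⁴` whose components, up to order and sign, give the three bundle maps `π_i^♯`. -/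
noncomputable def quat (A : LinearMap.BilinForm ℝ 𝔤) (x u : Fin 3 → 𝔤) : Fin 4 → 𝔤 :=
  ![-⁅u 0, x 0⁆ - ⁅u 1, x 1⁆ - ⁅u 2, x 2⁆,
    contract A (u 0) + ⁅u 1, x 2⁆ - ⁅u 2, x 1⁆,
    -⁅u 0, x 2⁆ + contract A (u 1) + ⁅u 2, x 0⁆,
    ⁅u 0, x 1⁆ - ⁅u 1, x 0⁆ + contract A (u 2)]

variable {A : LinearMap.BilinForm ℝ 𝔤} {x : Fin 3 → 𝔤}

/-- The four equations of the system, with the last one moved to the front, are the components of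
one equation in `𝔤⁴`. -/
theorem exists_quat_eq_generator (h : SystemSolvable A x) (ξ : 𝔤) :
    ∃ s, quat A x s = ![contract A ξ, ⁅ξ, x 0⁆, ⁅ξ, x 1⁆, ⁅ξ, x 2⁆] := by
  obtain ⟨u, v, w, h1, h2, h3, h0⟩ := h ξ
  refine ⟨![u, v, w], ?_⟩
  simp [-lie_skew, quat, h1, h2, h3, h0]

theorem quat_sub (u v : Fin 3 → 𝔤) : quat A x (u - v) = quat A x u - quat A x v := by
  ext i
  fin_cases i <;> simp [-lie_skew, quat, sub_eq_add_neg] <;> abel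

/-- Multiplying `quat u` by `i` gives `quat (e₁ × u)` up to the error `(A^♯ u₀, [u₀, x])`, and
solvability puts exactly this error in the range. The units `j` and `k` behave in the same way with
`e₂ × u`, `u₁` and `e₃ × u`, `u₂`. -/
theorem exists_quat_eq_quatI (h : SystemSolvable A x) (u : Fin 3 → 𝔤) :
    ∃ r, quat A x r = quatI (quat A x u) := by
  obtain ⟨s, hs⟩ := exists_quat_eq_generator h (u 0)
  refine ⟨![0, -u 2, u 1] - s, ?_⟩
  rw [quat_sub, hs]
  ext i
  fin_cases i <;> simp [-lie_skew, quat, quatI] <;> abel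

theorem exists_quat_eq_quatJ (h : SystemSolvable A x) (u : Fin 3 → 𝔤) :
    ∃ r, quat A x r = quatJ (quat A x u) := by
  obtain ⟨s, hs⟩ := exists_quat_eq_generator h (u 1)
  refine ⟨![u 2, 0, -u 0] - s, ?_⟩
  rw [quat_sub, hs]
  ext i
  fin_cases i <;> simp [-lie_skew, quat, quatJ] <;> abel

theorem exists_quat_eq_quatK (h : SystemSolvable A x) (u : Fin 3 → 𝔤) :
    ∃ r, quat A x r = quatK (quat A x u) := by
  obtain ⟨s, hs⟩ := exists_quat_eq_generator h (u 2)
  refine ⟨![-u 1, u 0, 0] - s, ?_⟩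
  rw [quat_sub, hs]
  ext i
  fin_cases i <;> simp [-lie_skew, quat, quatK] <;> abel

/-- The imaginary part of `quat` is symmetric for the Killing form. -/
theorem sum_killingForm_quatIm (hA : ∀ ξ η, A ξ η = A η ξ) (u v : Fin 3 → 𝔤) :
    ∑ i, killingForm ℝ 𝔤 (v i) (quatIm (quat A x u) i)
      = ∑ i, killingForm ℝ 𝔤 (u i) (quatIm (quat A x v) i) := by
  have hl : ∀ a b c : 𝔤, killingForm ℝ 𝔤 a ⁅b, c⁆ = -killingForm ℝ 𝔤 b ⁅a, c⁆ := by
    intro a b c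
    rw [← killingForm_lie_left, ← killingForm_lie_left, ← lie_skew, map_neg, LinearMap.neg_apply]
  have hc : ∀ a b : 𝔤, killingForm ℝ 𝔤 a (contract A b) = A a b := by
    intro a b
    rw [killingForm_comm, killingForm_contract, hA]
  simp only [Fin.sum_univ_three, quatIm, quat, Matrix.cons_val, map_add, map_sub, map_neg, hc]
  -- The diagonal blocks `A^♯` are symmetric; each `ad x_i` is skew but occurs in two transposed
  -- blocks with opposite signs, so the off-diagonal part is symmetric too.
  rw [hA (v 0), hA (v 1), hA (v 2), hl (v 0) (u 1), hl (v 0) (u 2), hl (v 1) (u 0),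
    hl (v 1) (u 2), hl (v 2) (u 0), hl (v 2) (u 1)]
  ring

/-- The bundle map `π^♯` in terms of the components of covectors. -/
theorem sharp_tensor (A : (Fin 3 → 𝔤) → LinearMap.BilinForm ℝ 𝔤) (x : Fin 3 → 𝔤)
    (α : Module.Dual ℝ (Fin 3 → 𝔤)) :
    sharp (tensor A x) α =
      quatIm (quatI (quat (A x) x fun i => covectorComp i α)) := by
  ext j
  apply eq_of_forall_killingForm
  intro η
  have h1 : killingForm ℝ 𝔤 (sharp (tensor A x) α j) η = tensor A x α (linFun j η) := by
    rw [← apply_sharp, killingForm_comm]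
    rfl
  have h2 : tensor A x α (linFun j η) = ∑ i, bracketTable (A x) x i j (covectorComp i α) η := by
    simp only [tensor, LinearMap.sum_apply, LinearMap.compl₁₂_apply, covectorComp_linFun]
    refine Finset.sum_congr rfl fun i _ => ?_
    rw [Finset.sum_eq_single j]
    · simp
    · intro k _ hk; simp [hk.symm]
    · simp
  have h3 : ∀ c u : 𝔤, lieForm c u η = -killingForm ℝ 𝔤 ⁅u, c⁆ η := fun c u =>
    killingForm_lie_swap u η c
  rw [h1, h2]
  fin_cases j <;>
    simp [-lie_skew, Fin.sum_univ_three, bracketTable, quatIm, quatI, quat, killingForm_contract,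
      h3] <;> ring

theorem tensor_skew {A : (Fin 3 → 𝔤) → LinearMap.BilinForm ℝ 𝔤} {x : Fin 3 → 𝔤}
    (hA : ∀ ξ η, A x ξ η = A x η ξ) (α β : Module.Dual ℝ (Fin 3 → 𝔤)) :
    tensor A x α β = -tensor A x β α := by
  have hl : ∀ c u v : 𝔤, lieForm c u v = -lieForm c v u := by
    intro c u v
    change killingForm ℝ 𝔤 ⁅u, v⁆ c = -killingForm ℝ 𝔤 ⁅v, u⁆ c
    rw [← lie_skew, map_neg, LinearMap.neg_apply]
  have hb : ∀ i j u v, bracketTable (A x) x i j u v = -bracketTable (A x) x j i v u := by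
    intro i j u v
    fin_cases i <;> fin_cases j <;> simp [bracketTable, hl _ u v, hA u v]
  simp only [tensor, LinearMap.sum_apply, LinearMap.compl₁₂_apply]
  rw [Finset.sum_comm, ← Finset.sum_neg_distrib]
  refine Finset.sum_congr rfl fun i _ => ?_
  rw [← Finset.sum_neg_distrib]
  exact Finset.sum_congr rfl fun j _ => hb _ _ _ _

theorem apply_eq_sum_covectorComp (α : Module.Dual ℝ (Fin 3 → 𝔤)) (y : Fin 3 → 𝔤) :
    α y = ∑ i, killingForm ℝ 𝔤 (covectorComp i α) (y i) := by
  have h : ∀ i, killingForm ℝ 𝔤 (covectorComp i α) (y i) = α (Pi.single i (y i)) := by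
    intro i
    rw [← killingDual_apply]
    simp [covectorComp]
  simp only [h]
  rw [← map_sum]
  congr 1
  ext i
  simp

end Quaternionic


/-! ### The three tensors on `L(𝔤, V)` and their pseudo-metric. -/

section FrameTensors

variable {𝔤 : Type*} [LieRing 𝔤] [LieAlgebra ℝ 𝔤] [Module.Finite ℝ 𝔤] [LieAlgebra.IsKilling ℝ 𝔤]
  {V : Type*} [NormedAddCommGroup V] [InnerProductSpace ℝ V]

/-- The components of a covector on `L(𝔤, V)` in the identification given by a frame. -/
noncomputable def frameComp (F : OrthonormalBasis (Fin 3) ℝ V) (i : Fin 3) :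
    Module.Dual ℝ (𝔤 →ₗ[ℝ] V) →ₗ[ℝ] 𝔤 :=
  covectorComp i ∘ₗ (frameIdent F).symm.dualMap.toLinearMap

theorem apply_eq_sum_frameComp (F : OrthonormalBasis (Fin 3) ℝ V)
    (α : Module.Dual ℝ (𝔤 →ₗ[ℝ] V)) (ψ : 𝔤 →ₗ[ℝ] V) :
    α ψ = ∑ i, killingForm ℝ 𝔤 (frameComp F i α) (frameIdent F ψ i) := by
  have := apply_eq_sum_covectorComp ((frameIdent F).symm.dualMap α) (frameIdent F ψ)
  simpa [frameComp] using this

theorem exists_frameComp_eq (F : OrthonormalBasis (Fin 3) ℝ V) (u : Fin 3 → 𝔤) :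
    ∃ α, (fun i => frameComp F i α) = u := by
  refine ⟨(frameIdent F).dualMap (∑ i, linFun i (u i)), ?_⟩
  have h : (frameIdent F).symm.dualMap ((frameIdent F).dualMap (∑ i, linFun i (u i)))
      = ∑ i, linFun i (u i) := by
    ext y
    simp
  ext i
  simp only [frameComp, LinearMap.comp_apply, LinearEquiv.coe_coe, h]
  simp [covectorComp_linFun]

theorem frameIdent_cyclicFrame (F : OrthonormalBasis (Fin 3) ℝ V) (k j : Fin 3) (φ : 𝔤 →ₗ[ℝ] V) :
    frameIdent (cyclicFrame F k) φ j = frameIdent F φ (j + k) := by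
  simp [frameIdent, cyclicFrame_apply]

theorem frameComp_cyclicFrame (F : OrthonormalBasis (Fin 3) ℝ V) (k j : Fin 3)
    (α : Module.Dual ℝ (𝔤 →ₗ[ℝ] V)) :
    frameComp (cyclicFrame F k) j α = frameComp F (j + k) α := by
  have h : ∀ η : 𝔤, (frameIdent (cyclicFrame F k)).symm (Pi.single j η)
      = (frameIdent F).symm (Pi.single (j + k) η) := by
    intro η
    rw [LinearEquiv.symm_apply_eq]
    ext i
    rw [frameIdent_cyclicFrame, LinearEquiv.apply_symm_apply]
    simp [Pi.single_apply]
  simp only [frameComp, LinearMap.comp_apply, covectorComp, LinearEquiv.coe_coe]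
  congr 1
  ext η
  simp [h]

theorem frameTensor_skew {A : (Fin 3 → 𝔤) → LinearMap.BilinForm ℝ 𝔤}
    {F : OrthonormalBasis (Fin 3) ℝ V} {φ : 𝔤 →ₗ[ℝ] V}
    (hA : ∀ ξ η, A (frameIdent F φ) ξ η = A (frameIdent F φ) η ξ)
    (α β : Module.Dual ℝ (𝔤 →ₗ[ℝ] V)) :
    frameTensor A F φ α β = -frameTensor A F φ β α :=
  tensor_skew hA _ _

theorem cyclicFrame_zero (F : OrthonormalBasis (Fin 3) ℝ V) : cyclicFrame F 0 = F := by
  refine DFunLike.ext _ _ fun j => ?_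
  rw [cyclicFrame_apply, add_zero]

variable [FiniteDimensional ℝ V]

theorem frameIdent_sharp (A : (Fin 3 → 𝔤) → LinearMap.BilinForm ℝ 𝔤)
    (F : OrthonormalBasis (Fin 3) ℝ V) (φ : 𝔤 →ₗ[ℝ] V) (α : Module.Dual ℝ (𝔤 →ₗ[ℝ] V)) :
    frameIdent F (sharp (frameTensor A F φ) α) =
      quatIm (quatI (quat (A (frameIdent F φ)) (frameIdent F φ) fun i => frameComp F i α)) := by
  have h := sharp_tensor A (frameIdent F φ) ((frameIdent F).symm.dualMap α)
  refine Eq.trans ?_ h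
  refine eq_of_forall_dual fun β => ?_
  rw [apply_sharp]
  have := apply_sharp (frameTensor A F φ) α ((frameIdent F).dualMap β)
  rw [LinearEquiv.dualMap_apply] at this
  rw [this]
  simp only [frameTensor, LinearMap.compl₁₂_apply, LinearEquiv.coe_coe]
  congr 1
  ext y
  simp

variable {A : (Fin 3 → 𝔤) → LinearMap.BilinForm ℝ 𝔤} {F : OrthonormalBasis (Fin 3) ℝ V}
  {φ : 𝔤 →ₗ[ℝ] V}

theorem exists_quat_eq_quatUnit {A : LinearMap.BilinForm ℝ 𝔤} {x : Fin 3 → 𝔤}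
    (h : SystemSolvable A x) (i : Fin 3) (u : Fin 3 → 𝔤) :
    ∃ r, quat A x r = quatUnit i (quat A x u) := by
  fin_cases i
  · exact exists_quat_eq_quatI h u
  · exact exists_quat_eq_quatJ h u
  · exact exists_quat_eq_quatK h u

/-- A unit has fourth power `1`, so its cube inverts it without leaving the range of `quat`. -/
theorem exists_quatUnit_quat_eq {A : LinearMap.BilinForm ℝ 𝔤} {x : Fin 3 → 𝔤}
    (h : SystemSolvable A x) (i : Fin 3) (u : Fin 3 → 𝔤) :
    ∃ r, quatUnit i (quat A x r) = quat A x u := by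
  obtain ⟨r₁, h₁⟩ := exists_quat_eq_quatUnit h i u
  obtain ⟨r₂, h₂⟩ := exists_quat_eq_quatUnit h i r₁
  obtain ⟨r₃, h₃⟩ := exists_quat_eq_quatUnit h i r₂
  exact ⟨r₃, by rw [h₃, h₂, h₁, quatUnit_iterate]⟩

/-- The three bundle maps `π_i^♯` on `L(𝔤, V)`, in the identification given by the first frame. -/
theorem frameIdent_sharp_cyclicFrame
    (hA : ∀ k, A (frameIdent (cyclicFrame F k) φ) = A (frameIdent F φ)) (k : Fin 3)
    (α : Module.Dual ℝ (𝔤 →ₗ[ℝ] V)) :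
    frameIdent F (sharp (frameTensor A (cyclicFrame F k) φ) α) =
      quatIm (quatUnit k
        (quat (A (frameIdent F φ)) (frameIdent F φ) fun i => frameComp F i α)) := by
  -- `quat` commutes with a simultaneous cyclic permutation of `x` and `u`, which fixes the real
  -- part; this permutation turns `i` into the `k`-th unit.
  have h : ∀ j, frameIdent F (sharp (frameTensor A (cyclicFrame F k) φ) α) (j + k) = _ :=
    fun j => by rw [← frameIdent_cyclicFrame, frameIdent_sharp, hA]
  ext j
  have h0 := h (j - k)
  rw [sub_add_cancel] at h0
  rw [h0]
  fin_cases k <;> fin_cases j <;>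
    simp [-lie_skew, quatUnit, quatIm, quatI, quatJ, quatK, quat, frameIdent_cyclicFrame,
      frameComp_cyclicFrame, (by decide : (1 : Fin 3) + 1 = 2), (by decide : (1 : Fin 3) + 2 = 0),
      (by decide : (2 : Fin 3) + 1 = 0), (by decide : (2 : Fin 3) + 2 = 1),
      (by decide : (0 : Fin 3) - 1 = 2), (by decide : (0 : Fin 3) - 2 = 1),
      (by decide : (1 : Fin 3) - 2 = 2), (by decide : (2 : Fin 3) - 1 = 1)] <;> abel

/-- The unit acts bijectively on the range of `quat`, so it drops out: the right-hand side does not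
depend on `k`. -/
theorem mem_leafTangent_cyclicFrame
    (hA : ∀ k, A (frameIdent (cyclicFrame F k) φ) = A (frameIdent F φ))
    (hS : SystemSolvable (A (frameIdent F φ)) (frameIdent F φ)) (k : Fin 3) (ψ : 𝔤 →ₗ[ℝ] V) :
    ψ ∈ leafTangent (frameTensor A (cyclicFrame F k) φ) ↔
      ∃ u, frameIdent F ψ = quatIm (quat (A (frameIdent F φ)) (frameIdent F φ) u) := by
  constructor
  · rintro ⟨α, rfl⟩
    obtain ⟨r, hr⟩ := exists_quat_eq_quatUnit hS k fun i => frameComp F i α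
    exact ⟨r, by rw [frameIdent_sharp_cyclicFrame hA, hr]⟩
  · rintro ⟨u, hu⟩
    obtain ⟨r, hr⟩ := exists_quatUnit_quat_eq hS k u
    obtain ⟨α, rfl⟩ := exists_frameComp_eq F r
    refine ⟨α, (frameIdent F).injective ?_⟩
    rw [frameIdent_sharp_cyclicFrame hA, hr, hu]

theorem leafTangent_cyclicFrame
    (hA : ∀ k, A (frameIdent (cyclicFrame F k) φ) = A (frameIdent F φ))
    (hS : SystemSolvable (A (frameIdent F φ)) (frameIdent F φ)) (k : Fin 3) :
    leafTangent (frameTensor A (cyclicFrame F k) φ) = leafTangent (frameTensor A F φ) := by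
  ext ψ
  have h := mem_leafTangent_cyclicFrame hA hS 0 ψ
  rw [cyclicFrame_zero] at h
  rw [mem_leafTangent_cyclicFrame hA hS, h]

theorem isPseudoMetric_symm
    (hsymm : ∀ ξ η, A (frameIdent F φ) ξ η = A (frameIdent F φ) η ξ)
    (hA : ∀ k, A (frameIdent (cyclicFrame F k) φ) = A (frameIdent F φ))
    (hS : SystemSolvable (A (frameIdent F φ)) (frameIdent F φ))
    {T : Submodule ℝ (𝔤 →ₗ[ℝ] V)} {g : T →ₗ[ℝ] Module.Dual ℝ T}
    (hg : IsPseudoMetric (fun i => frameTensor A (cyclicFrame F i) φ) T g) (v w : T) :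
    g v w = g w v := by
  refine hg.symm (fun i => frameTensor_skew (by rw [hA]; exact hsymm))
    (s := fun α => (frameIdent F).symm (quatIm
      (quat (A (frameIdent F φ)) (frameIdent F φ) fun i => frameComp F i α))) ?_ ?_ v w
  · intro α β
    simp only [apply_eq_sum_frameComp F, LinearEquiv.apply_symm_apply]
    exact sum_killingForm_quatIm hsymm _ _
  · intro α
    -- With `j · quat r = quat α`, the relation `ij = k` gives `k · quat r = i · quat α`, so `r`
    -- serves both requirements.
    obtain ⟨r, hr⟩ := exists_quatUnit_quat_eq hS 1 fun i => frameComp F i α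
    obtain ⟨β, rfl⟩ := exists_frameComp_eq F r
    refine ⟨β, (frameIdent F).injective ?_, (frameIdent F).injective ?_⟩
    · rw [frameIdent_sharp_cyclicFrame hA, frameIdent_sharp_cyclicFrame hA, ← hr]
      ext j
      fin_cases j <;> simp [quatUnit, quatI, quatJ, quatK, quatIm]
    · rw [frameIdent_sharp_cyclicFrame hA, hr, LinearEquiv.apply_symm_apply]

theorem generator_mem_leafTangent
    (hA : ∀ k, A (frameIdent (cyclicFrame F k) φ) = A (frameIdent F φ))
    (hS : SystemSolvable (A (frameIdent F φ)) (frameIdent F φ)) (ξ : 𝔤) :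
    generator ξ φ ∈ leafTangent (frameTensor A F φ) := by
  rw [← leafTangent_cyclicFrame hA hS 0, mem_leafTangent_cyclicFrame hA hS]
  obtain ⟨s, hs⟩ := exists_quat_eq_generator hS ξ
  refine ⟨s, ?_⟩
  rw [hs]
  ext j
  rw [frameIdent_generator]
  fin_cases j <;> simp [quatIm]

theorem isPseudoMetric_generator
    (hsymm : ∀ ξ η, A (frameIdent F φ) ξ η = A (frameIdent F φ) η ξ)
    (hA : ∀ k, A (frameIdent (cyclicFrame F k) φ) = A (frameIdent F φ))
    {T : Submodule ℝ (𝔤 →ₗ[ℝ] V)} {g : T →ₗ[ℝ] Module.Dual ℝ T}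
    (hg : IsPseudoMetric (fun i => frameTensor A (cyclicFrame F i) φ) T g) (ξ : 𝔤)
    (h : generator ξ φ ∈ T) :
    g ⟨generator ξ φ, h⟩ ⟨generator ξ φ, h⟩ = -A (frameIdent F φ) ξ ξ := by
  -- Potentials of the generator: `π₂^♯ α = ξ̂` and `π₃^♯ γ = -ξ̂`.
  obtain ⟨α, hα⟩ := exists_frameComp_eq F ![0, -ξ, 0]
  obtain ⟨γ, hγ⟩ := exists_frameComp_eq F ![0, 0, ξ]
  have h1 : sharp (frameTensor A (cyclicFrame F 1) φ) α = generator ξ φ := by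
    apply (frameIdent F).injective
    rw [frameIdent_sharp_cyclicFrame hA, hα]
    ext j
    rw [frameIdent_generator]
    fin_cases j <;> simp [-lie_skew, quatUnit, quatJ, quatIm, quat]
  have h2 : sharp (frameTensor A (cyclicFrame F 2) φ) γ = -generator ξ φ := by
    apply (frameIdent F).injective
    rw [frameIdent_sharp_cyclicFrame hA, hγ, map_neg]
    ext j
    rw [Pi.neg_apply, frameIdent_generator]
    fin_cases j <;> simp [-lie_skew, quatUnit, quatK, quatIm, quat]
  obtain ⟨β, hβ⟩ : sharp (frameTensor A (cyclicFrame F 0) φ) α ∈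
      leafTangent (frameTensor A (cyclicFrame F 2) φ) := by
    rw [hg.leafTangent_eq 2, ← hg.leafTangent_eq 0]
    exact sharp_mem_leafTangent _ _
  rw [hg.apply_eq (α := α) (β := β) h1 hβ]
  change β (generator ξ φ) = _
  -- Skewness removes the inexplicit `β`: `β(ξ̂) = -β(π₃^♯ γ) = γ(π₃^♯ β) = γ(π₁^♯ α)`.
  rw [← neg_neg (generator ξ φ), ← h2, map_neg, apply_sharp,
    frameTensor_skew (by rw [hA]; exact hsymm), neg_neg, ← apply_sharp, hβ,
    apply_eq_sum_frameComp F, frameIdent_sharp_cyclicFrame hA, hα]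
  have hγ' : ∀ i, frameComp F i γ = ![0, 0, ξ] i := fun i => congrFun hγ i
  simp only [hγ', Fin.sum_univ_three]
  simp [quatUnit, quatI, quatIm, quat]
  rw [killingForm_comm, killingForm_contract]

end FrameTensors


/-! ### Logarithms of automorphisms near the identity. -/

section ExpDerivation

open NormedSpace Filter Topology

variable {E : Type*} [NormedAddCommGroup E] [NormedSpace ℝ E] [CompleteSpace E]

theorem exp_neg_apply_exp_apply (D : E →L[ℝ] E) (x : E) : exp D (exp (-D) x) = x := by
  have h : exp D * exp (-D) = 1 := by
    let _ : NormedAlgebra ℚ (E →L[ℝ] E) := .restrictScalars ℚ ℝ _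
    rw [← exp_add_of_commute (Commute.neg_right (Commute.refl D)), add_neg_cancel, exp_zero]
  exact congrArg (fun S : E →L[ℝ] E => S x) h

/-- The defect of the derivation property of `D` for the product `B`. -/
noncomputable def derivationDefect (B : E →L[ℝ] E →L[ℝ] E) (D : E →L[ℝ] E) : E →L[ℝ] E →L[ℝ] E :=
  (ContinuousLinearMap.compL ℝ E E E D) ∘L B - B ∘L D -
    ((ContinuousLinearMap.compL ℝ E E E).flip D) ∘L B

omit [CompleteSpace E] in
theorem derivationDefect_apply (B : E →L[ℝ] E →L[ℝ] E) (D : E →L[ℝ] E) (x y : E) :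
    derivationDefect B D x y = D (B x y) - B (D x) y - B x (D y) := rfl

theorem hasDerivAt_exp_conj (B : E →L[ℝ] E →L[ℝ] E) (D : E →L[ℝ] E) (x y : E) (t : ℝ) :
    HasDerivAt (fun s : ℝ => exp (s • D) (B (exp (s • -D) x) (exp (s • -D) y)))
      (exp (t • D) (derivationDefect B D (exp (t • -D) x) (exp (t • -D) y))) t := by
  have h1 : HasDerivAt (fun s : ℝ => exp (s • D)) (exp (t • D) * D) t :=
    hasDerivAt_exp_smul_const D t
  have h2 : HasDerivAt (fun s : ℝ => exp (s • -D)) (-D * exp (t • -D)) t :=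
    hasDerivAt_exp_smul_const' (-D) t
  have hx := h2.clm_apply (hasDerivAt_const t x)
  have hy := h2.clm_apply (hasDerivAt_const t y)
  have hB := (((hasDerivAt_const t B).clm_apply hx).clm_apply hy)
  refine (h1.clm_apply hB).congr_deriv ?_
  simp [derivationDefect_apply]
  abel

omit [CompleteSpace E] in
-- Three increments contribute `0.121 + 0.11 + 0.1 = 0.331`; all that matters later is a factor
-- below `1`.
theorem norm_near_one_conj_sub_le (β : E →L[ℝ] E →L[ℝ] E) {S T : E →L[ℝ] E}
    (hS : ‖S - 1‖ ≤ 1 / 10) (hT : ‖T - 1‖ ≤ 1 / 10) (x y : E) :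
    ‖S (β (T x) (T y)) - β x y‖ ≤ 1 / 2 * ‖β‖ * ‖x‖ * ‖y‖ := by
  have hd : ∀ R : E →L[ℝ] E, ‖R - 1‖ ≤ 1 / 10 → ∀ z, ‖R z - z‖ ≤ 1 / 10 * ‖z‖ := by
    intro R hR z
    exact ((R - 1).le_opNorm z).trans (by gcongr)
  have hn : ∀ z, ‖T z‖ ≤ 11 / 10 * ‖z‖ := by
    intro z
    have := norm_add_le (T z - z) z
    rw [sub_add_cancel] at this
    linarith [hd T hT z]
  have e : S (β (T x) (T y)) - β x y = (S (β (T x) (T y)) - β (T x) (T y)) +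
      β (T x - x) (T y) + β x (T y - y) := by
    simp
  have hP : 0 ≤ ‖β‖ * ‖x‖ * ‖y‖ := by positivity
  have b1 : ‖β (T x) (T y)‖ ≤ ‖β‖ * (11 / 10 * ‖x‖) * (11 / 10 * ‖y‖) :=
    (β.le_opNorm₂ _ _).trans (by gcongr <;> exact hn _)
  have b2 : ‖β (T x - x) (T y)‖ ≤ ‖β‖ * (1 / 10 * ‖x‖) * (11 / 10 * ‖y‖) :=
    (β.le_opNorm₂ _ _).trans (by gcongr; exacts [hd T hT x, hn _])
  have b3 : ‖β x (T y - y)‖ ≤ ‖β‖ * ‖x‖ * (1 / 10 * ‖y‖) :=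
    (β.le_opNorm₂ _ _).trans (by gcongr; exact hd T hT y)
  rw [e]
  refine (norm_add₃_le).trans ?_
  have b0 := hd S hS (β (T x) (T y))
  nlinarith

/-- The logarithm of an automorphism close to the identity is a derivation. -/
theorem eventually_derivation_of_exp_automorphism :
    ∀ᶠ D : E →L[ℝ] E in 𝓝 0, ∀ B : E →L[ℝ] E →L[ℝ] E,
      (∀ x y, exp D (B x y) = B (exp D x) (exp D y)) →
        ∀ x y, D (B x y) = B (D x) y + B x (D y) := by
  have hc : Tendsto (fun D : E →L[ℝ] E => exp D) (𝓝 0) (𝓝 1) := by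
    let _ : NormedAlgebra ℚ (E →L[ℝ] E) := .restrictScalars ℚ ℝ _
    have := (exp_continuous (𝔸 := E →L[ℝ] E)).tendsto 0
    rwa [exp_zero] at this
  have h1 : ∀ᶠ D : E →L[ℝ] E in 𝓝 0, ‖exp D - 1‖ < 1 / 10 := by
    have := hc.eventually (Metric.ball_mem_nhds (1 : E →L[ℝ] E) (by norm_num : (0 : ℝ) < 1 / 10))
    simpa [dist_eq_norm] using this
  obtain ⟨r, hr, hball⟩ := Metric.eventually_nhds_iff_ball.1 h1
  filter_upwards [Metric.ball_mem_nhds (0 : E →L[ℝ] E) hr] with D hD B hB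
  have hsmall : ∀ t ∈ Set.Icc (0 : ℝ) 1, ∀ D' : E →L[ℝ] E, ‖D'‖ = ‖D‖ →
      ‖exp (t • D') - 1‖ ≤ 1 / 10 := by
    intro t ht D' hD'
    refine (hball (t • D') ?_).le
    rw [mem_ball_zero_iff] at hD ⊢
    rw [norm_smul, hD', Real.norm_of_nonneg ht.1]
    exact (mul_le_of_le_one_left (norm_nonneg _) ht.2).trans_lt hD
  set β := derivationDefect B D with hβ
  have key : ∀ x y, ‖β x y‖ ≤ 1 / 2 * ‖β‖ * ‖x‖ * ‖y‖ := by
    intro x y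
    -- The transported product equals `B x y` at both times `0` and `1`, while its velocity stays
    -- within `½‖β‖‖x‖‖y‖` of the constant `β x y`. Subtracting `s • β x y` makes the mean value
    -- inequality bound `β x y` itself, which forces `β = 0`.
    have hder : ∀ t ∈ Set.Icc (0 : ℝ) 1, HasDerivWithinAt
        (fun s : ℝ => exp (s • D) (B (exp (s • -D) x) (exp (s • -D) y)) - s • β x y)
        (exp (t • D) (β (exp (t • -D) x) (exp (t • -D) y)) - β x y) (Set.Icc 0 1) t := by
      intro t _
      refine (((hasDerivAt_exp_conj B D x y t).sub
        ((hasDerivAt_id t).smul_const (β x y))).congr_deriv ?_).hasDerivWithinAt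
      rw [one_smul]
    have hbound : ∀ t ∈ Set.Ico (0 : ℝ) 1,
        ‖exp (t • D) (β (exp (t • -D) x) (exp (t • -D) y)) - β x y‖
          ≤ 1 / 2 * ‖β‖ * ‖x‖ * ‖y‖ := fun t ht =>
      norm_near_one_conj_sub_le β (hsmall t ⟨ht.1, ht.2.le⟩ D rfl)
        (hsmall t ⟨ht.1, ht.2.le⟩ (-D) (norm_neg D)) x y
    have := norm_image_sub_le_of_norm_deriv_le_segment_01' hder hbound
    simpa [hB, exp_neg_apply_exp_apply, exp_zero] using this
  have hβ0 : ‖β‖ ≤ 0 := by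
    have h := β.opNorm_le_bound₂ (by positivity) key
    linarith
  intro x y
  have h0 : β x y = 0 := by
    rw [← norm_le_zero_iff]
    refine (β.le_opNorm₂ x y).trans ?_
    rw [hβ0.antisymm β.opNorm_nonneg, zero_mul, zero_mul]
  rw [hβ, derivationDefect_apply, sub_sub, sub_eq_zero] at h0
  exact h0

/-- Inverse function theorem: `exp` has derivative the identity at `0`. -/
theorem map_exp_nhds_zero : map (exp : (E →L[ℝ] E) → E →L[ℝ] E) (𝓝 0) = 𝓝 1 := by
  have h := (hasStrictFDerivAt_exp_zero (𝕂 := ℝ) (𝔸 := E →L[ℝ] E))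
  have := HasStrictFDerivAt.map_nhds_eq_of_equiv
    (f' := ContinuousLinearEquiv.refl ℝ (E →L[ℝ] E)) h
  rwa [exp_zero] at this

end ExpDerivation

/-! ### Automorphisms of a Killing Lie algebra near the identity. -/

section InnerAutomorphisms

open NormedSpace Filter Topology

variable {𝔤 : Type*} [LieRing 𝔤] [LieAlgebra ℝ 𝔤] [Module.Finite ℝ 𝔤] [LieAlgebra.IsKilling ℝ 𝔤]
  {E : Type*} [NormedAddCommGroup E] [NormedSpace ℝ E]

/-- The endomorphism of `𝔤` corresponding to an endomorphism of a normed space that `𝔤` is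
identified with. -/
def endOf (c : 𝔤 ≃ₗ[ℝ] E) (S : E →L[ℝ] E) : 𝔤 →ₗ[ℝ] 𝔤 :=
  c.symm.toLinearMap ∘ₗ S.toLinearMap ∘ₗ c.toLinearMap

variable [FiniteDimensional ℝ E]

/-- Automorphisms of a semisimple Lie algebra close to the identity are of the form `exp (ad ξ)`. -/
theorem eventually_automorphism_eq_exp_ad (c : 𝔤 ≃ₗ[ℝ] E) {P : Set (E →L[ℝ] E)} (hP : P ∈ 𝓝 0) :
    ∀ᶠ S : E →L[ℝ] E in 𝓝 1,
      (∀ ξ η, endOf c S ⁅ξ, η⁆ = ⁅endOf c S ξ, endOf c S η⁆) →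
        ∃ D ∈ P, ∃ ξ : 𝔤, endOf c D = LieAlgebra.ad ℝ 𝔤 ξ ∧ exp D = S := by
  have : CompleteSpace E := FiniteDimensional.complete ℝ E
  rw [← map_exp_nhds_zero, eventually_map]
  filter_upwards [hP, eventually_derivation_of_exp_automorphism (E := E)] with D hDP hD hS
  let B : E →L[ℝ] E →L[ℝ] E := LinearMap.toContinuousLinearMap
    ((LinearMap.toContinuousLinearMap : (E →ₗ[ℝ] E) ≃ₗ[ℝ] E →L[ℝ] E).toLinearMap ∘ₗ
      (LinearMap.mk₂ ℝ (fun x y => c ⁅c.symm x, c.symm y⁆)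
        (by simp) (by simp) (by simp) (by simp)))
  have hB : ∀ x y, B x y = c ⁅c.symm x, c.symm y⁆ := fun x y => rfl
  have hd := hD B (by
    intro x y
    have := congrArg c (hS (c.symm x) (c.symm y))
    simpa [endOf, hB] using this)
  let δ : LieDerivation ℝ 𝔤 𝔤 :=
    { endOf c D with
      leibniz' := by
        intro a b
        have := congrArg c.symm (hd (c a) (c b))
        simp only [hB, LinearEquiv.symm_apply_apply, map_add] at this
        change c.symm (D (c ⁅a, b⁆)) = ⁅a, c.symm (D (c b))⁆ - ⁅b, c.symm (D (c a))⁆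
        rw [this, ← lie_skew b]
        abel }
  obtain ⟨ξ, hξ⟩ := LieDerivation.IsKilling.exists_eq_ad δ
  refine ⟨D, hDP, ξ, ?_, rfl⟩
  ext η
  have := congrArg (fun d : LieDerivation ℝ 𝔤 𝔤 => d η) hξ
  simpa [δ] using this.symm

end InnerAutomorphisms


/-! ### Symplectic leaves and their transport by linear isomorphisms. -/

section Leaves

variable {W : Type*} [AddCommGroup W] [Module ℝ W] [Module.Finite ℝ W]

theorem mem_of_mem_leafThrough {π : W → BiTensor W} {D : Set W} {x y : W} (hx : x ∈ D)
    (h : y ∈ leafThrough π D x) : y ∈ D := by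
  induction h with
  | refl => exact hx
  | tail _ h _ =>
    obtain ⟨f, γ, -, -, rfl, hγ⟩ := h
    exact (hγ 1 ⟨zero_le_one, le_rfl⟩).1

theorem differential_comp_linearEquiv (K : W ≃ₗ[ℝ] W) (f : W → ℝ) (x : W) :
    differential (fun y => f (K.symm y)) (K x) = K.symm.dualMap (differential f x) := by
  let L : (Fin (Module.finrank ℝ W) → ℝ) ≃L[ℝ] (Fin (Module.finrank ℝ W) → ℝ) :=
    ((coord W).symm ≪≫ₗ K.symm ≪≫ₗ coord W).toContinuousLinearEquiv
  have h : (fun y => f (K.symm ((coord W).symm y))) =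
      (fun y => f ((coord W).symm y)) ∘ L := by
    ext y
    simp [L]
  have hx : L (coord W (K x)) = coord W x := by simp [L]
  ext v
  simp only [differential, h, L.comp_right_fderiv, hx, LinearMap.comp_apply,
    LinearEquiv.dualMap_apply]
  simp [L]

theorem SmoothOn.comp_linearEquiv {f : W → ℝ} {D : Set W} (hf : SmoothOn f D) (K : W ≃ₗ[ℝ] W)
    (hK : ∀ x ∈ D, K.symm x ∈ D) : SmoothOn (fun y => f (K.symm y)) D := by
  let L : (Fin (Module.finrank ℝ W) → ℝ) ≃L[ℝ] (Fin (Module.finrank ℝ W) → ℝ) :=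
    ((coord W).symm ≪≫ₗ K.symm ≪≫ₗ coord W).toContinuousLinearEquiv
  have h : (fun y => f (K.symm ((coord W).symm y))) =
      (fun y => f ((coord W).symm y)) ∘ L := by
    ext y
    simp [L]
  rw [SmoothOn, h]
  refine ContDiffOn.comp hf L.contDiff.contDiffOn fun y hy => ?_
  have := hK _ hy
  simpa [L] using this

/-- The bundle maps of two tensors that correspond to each other under `K`. -/
theorem sharp_eq_map_sharp {π π' : BiTensor W} {K : W ≃ₗ[ℝ] W}
    (h : ∀ α β, π' α β = π (K.dualMap α) (K.dualMap β)) (α : Module.Dual ℝ W) :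
    sharp π' α = K (sharp π (K.dualMap α)) :=
  eq_of_forall_dual fun β => by
    rw [apply_sharp, h, ← apply_sharp, LinearEquiv.dualMap_apply]

theorem map_mem_leafTangent {π π' : BiTensor W} {K : W ≃ₗ[ℝ] W}
    (h : ∀ α β, π' α β = π (K.dualMap α) (K.dualMap β)) {v : W} (hv : v ∈ leafTangent π) :
    K v ∈ leafTangent π' := by
  obtain ⟨α, rfl⟩ := hv
  refine ⟨K.symm.dualMap α, ?_⟩
  rw [sharp_eq_map_sharp h]
  congr 2
  ext w
  simp

theorem image_leafTangent {π π' : BiTensor W} {K : W ≃ₗ[ℝ] W}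
    (h : ∀ α β, π' α β = π (K.dualMap α) (K.dualMap β)) :
    K '' (leafTangent π : Set W) = leafTangent π' := by
  ext w
  constructor
  · rintro ⟨v, hv, rfl⟩
    exact map_mem_leafTangent h hv
  · rintro ⟨α, rfl⟩
    exact ⟨_, sharp_mem_leafTangent π (K.dualMap α), (sharp_eq_map_sharp h α).symm⟩

theorem IsPseudoMetric.map_apply {π π' : Fin 3 → BiTensor W} {T T' : Submodule ℝ W}
    {g : T →ₗ[ℝ] Module.Dual ℝ T} {g' : T' →ₗ[ℝ] Module.Dual ℝ T'}
    (hg : IsPseudoMetric π T g) (hg' : IsPseudoMetric π' T' g') {K : W ≃ₗ[ℝ] W}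
    (h : ∀ i α β, π' i α β = π i (K.dualMap α) (K.dualMap β)) {v w : T} {v' w' : T'}
    (hv : (v' : W) = K v) (hw : (w' : W) = K w) : g' v' w' = g v w := by
  obtain ⟨α, β, h1, h2⟩ := IsPseudoMetric.exists_covectors hg.leafTangent_eq v
  have hK : ∀ α : Module.Dual ℝ W, K.dualMap (K.symm.dualMap α) = α := by
    intro α
    ext w
    simp
  rw [hg.apply_eq h1 h2, hg'.apply_eq (α := K.symm.dualMap α) (β := K.symm.dualMap β), hw,
    LinearEquiv.dualMap_apply, LinearEquiv.symm_apply_apply]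
  · rw [sharp_eq_map_sharp (h 1), hK, h1, hv]
  · rw [sharp_eq_map_sharp (h 2), sharp_eq_map_sharp (h 0), hK, hK, h2]

theorem HamiltonianStep.map {π : W → BiTensor W} {D : Set W} {K : W ≃ₗ[ℝ] W}
    (hK : ∀ x ∈ D, K x ∈ D) (hK' : ∀ x ∈ D, K.symm x ∈ D)
    (h : ∀ x ∈ D, ∀ α β, π (K x) α β = π x (K.dualMap α) (K.dualMap β)) {x y : W}
    (hxy : HamiltonianStep π D x y) : HamiltonianStep π D (K x) (K y) := by
  obtain ⟨f, γ, hf, rfl, rfl, hγ⟩ := hxy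
  refine ⟨fun y => f (K.symm y), fun t => K (γ t), hf.comp_linearEquiv K hK', rfl, rfl,
    fun t ht => ⟨hK _ (hγ t ht).1, fun β => ?_⟩⟩
  have hd := (hγ t ht).2 (K.dualMap β)
  have e : hamiltonianField π (fun y => f (K.symm y)) (K (γ t)) =
      K (hamiltonianField π f (γ t)) := by
    rw [hamiltonianField, hamiltonianField, sharp_eq_map_sharp (h _ (hγ t ht).1),
      differential_comp_linearEquiv]
    congr 2
    ext w
    simp
  rw [e]
  exact hd

theorem map_mem_leafThrough {π : W → BiTensor W} {D : Set W} {K : W ≃ₗ[ℝ] W}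
    (hK : ∀ x ∈ D, K x ∈ D) (hK' : ∀ x ∈ D, K.symm x ∈ D)
    (h : ∀ x ∈ D, ∀ α β, π (K x) α β = π x (K.dualMap α) (K.dualMap β)) {x y : W}
    (hy : y ∈ leafThrough π D x) : K y ∈ leafThrough π D (K x) :=
  Relation.ReflTransGen.lift K (fun _ _ => HamiltonianStep.map hK hK' h) _ _ hy

theorem image_leafThrough {π : W → BiTensor W} {D : Set W} {K : W ≃ₗ[ℝ] W}
    (hK : ∀ x ∈ D, K x ∈ D) (hK' : ∀ x ∈ D, K.symm x ∈ D)
    (h : ∀ x ∈ D, ∀ α β, π (K x) α β = π x (K.dualMap α) (K.dualMap β)) (x : W) :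
    K '' leafThrough π D x = leafThrough π D (K x) := by
  have h' : ∀ x ∈ D, ∀ α β,
      π (K.symm x) α β = π x (K.symm.dualMap α) (K.symm.dualMap β) := by
    intro x hx α β
    have e : ∀ α : Module.Dual ℝ W, K.dualMap (K.symm.dualMap α) = α := by
      intro α
      ext w
      simp
    have := h _ (hK' x hx) (K.symm.dualMap α) (K.symm.dualMap β)
    rw [LinearEquiv.apply_symm_apply, e, e] at this
    exact this.symm
  ext y
  constructor
  · rintro ⟨z, hz, rfl⟩
    exact map_mem_leafThrough hK hK' h hz
  · intro hy
    refine ⟨K.symm y, ?_, K.apply_symm_apply y⟩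
    have := map_mem_leafThrough (K := K.symm) hK' hK h' hy
    rwa [LinearEquiv.symm_apply_apply] at this

/-- Reverse time and negate the hamiltonian. Lying in the same leaf is thereby an equivalence
relation. -/
theorem HamiltonianStep.symm {π : W → BiTensor W} {D : Set W} {x y : W}
    (h : HamiltonianStep π D x y) : HamiltonianStep π D y x := by
  obtain ⟨f, γ, hf, rfl, rfl, hγ⟩ := h
  have hr : ∀ t ∈ Set.Icc (0 : ℝ) 1, 1 - t ∈ Set.Icc (0 : ℝ) 1 := fun t ht =>
    ⟨sub_nonneg.2 ht.2, sub_le_self _ ht.1⟩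
  refine ⟨fun z => -f z, fun t => γ (1 - t), ContDiffOn.neg hf, by simp, by simp,
    fun t ht => ⟨(hγ _ (hr t ht)).1, fun β => ?_⟩⟩
  have e : hamiltonianField π (fun z => -f z) (γ (1 - t)) =
      -hamiltonianField π f (γ (1 - t)) := by
    have : differential (fun z => -f z) (γ (1 - t)) = -differential f (γ (1 - t)) := by
      ext v
      simp [differential, fderiv_fun_neg]
    rw [hamiltonianField, this, map_neg, hamiltonianField]
  have hd := ((hγ _ (hr t ht)).2 β).scomp t
    ((hasDerivAt_id t).const_sub 1).hasDerivWithinAt hr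
  rw [e, map_neg]
  simpa [Function.comp_def] using hd

theorem leafThrough_eq_of_mem {π : W → BiTensor W} {D : Set W} {x y : W}
    (h : y ∈ leafThrough π D x) : leafThrough π D y = leafThrough π D x := by
  have : Std.Symm (HamiltonianStep π D) := ⟨fun _ _ => HamiltonianStep.symm⟩
  ext z
  exact ⟨fun hz => Relation.ReflTransGen.trans h hz,
    fun hz => Relation.ReflTransGen.trans (symm h) hz⟩

theorem smoothOn_dual (α : Module.Dual ℝ W) (D : Set W) : SmoothOn (fun y => α y) D := by
  have : ContDiff ℝ ∞ (LinearMap.toContinuousLinearMap (α ∘ₗ (coord W).symm.toLinearMap)) :=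
    ContinuousLinearMap.contDiff _
  exact this.contDiffOn

theorem differential_dual (α : Module.Dual ℝ W) (x : W) : differential (fun y => α y) x = α := by
  have h : fderiv ℝ (fun y => α ((coord W).symm y)) (coord W x) =
      LinearMap.toContinuousLinearMap (α ∘ₗ (coord W).symm.toLinearMap) :=
    (LinearMap.toContinuousLinearMap (α ∘ₗ (coord W).symm.toLinearMap)).fderiv
  ext v
  simp [differential, h]

end Leaves

/-! ### The flow of the generators stays in the leaves. -/

section Flow

open NormedSpace Filter Topology

variable {𝔤 : Type*} [LieRing 𝔤] [LieAlgebra ℝ 𝔤] [Module.Finite ℝ 𝔤] [LieAlgebra.IsKilling ℝ 𝔤]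
  {V : Type*} [NormedAddCommGroup V] [InnerProductSpace ℝ V] [FiniteDimensional ℝ V]
  {E : Type*} [NormedAddCommGroup E] [NormedSpace ℝ E]

/-- The generator of the action is the hamiltonian vector field of a linear function. -/
theorem exists_hamiltonianField_eq_generator (A : (Fin 3 → 𝔤) → LinearMap.BilinForm ℝ 𝔤)
    (F : OrthonormalBasis (Fin 3) ℝ V) (ξ : 𝔤) :
    ∃ α : Module.Dual ℝ (𝔤 →ₗ[ℝ] V), ∀ φ,
      hamiltonianField (frameTensor A F) (fun ψ => α ψ) φ = generator ξ φ := by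
  -- For this triple `A` enters only the `i`-component of `quat`, which multiplication by `i` moves
  -- to the discarded real part.
  obtain ⟨α, hα⟩ := exists_frameComp_eq F ![-ξ, 0, 0]
  refine ⟨α, fun φ => (frameIdent F).injective ?_⟩
  rw [hamiltonianField, differential_dual, frameIdent_sharp, hα]
  ext j
  rw [frameIdent_generator]
  fin_cases j <;> simp [-lie_skew, quatI, quatIm, quat]

/-- `S ↦ φ ∘ S` as a linear map. -/
def compEndOf (c : 𝔤 ≃ₗ[ℝ] E) (φ : 𝔤 →ₗ[ℝ] V) : (E →L[ℝ] E) →ₗ[ℝ] 𝔤 →ₗ[ℝ] V where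
  toFun S := φ ∘ₗ endOf c S
  map_add' S T := by ext; simp [endOf]
  map_smul' r S := by ext; simp [endOf]

variable [FiniteDimensional ℝ E]

/-- The curve `t ↦ φ ∘ exp (t ad ξ)` has velocity `ψ ∘ ad ξ` at its point `ψ`, which is the
generator of `-ξ`. -/
theorem hamiltonianStep_exp_ad (A : (Fin 3 → 𝔤) → LinearMap.BilinForm ℝ 𝔤)
    (F : OrthonormalBasis (Fin 3) ℝ V) (c : 𝔤 ≃ₗ[ℝ] E) {D : E →L[ℝ] E} {ξ : 𝔤}
    (hD : endOf c D = LieAlgebra.ad ℝ 𝔤 ξ) (φ : 𝔤 →ₗ[ℝ] V) {M : Set (𝔤 →ₗ[ℝ] V)}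
    (hM : ∀ t ∈ Set.Icc (0 : ℝ) 1, compEndOf c φ (exp (t • D)) ∈ M) :
    HamiltonianStep (frameTensor A F) M φ (compEndOf c φ (exp D)) := by
  have : CompleteSpace E := FiniteDimensional.complete ℝ E
  obtain ⟨α, hα⟩ := exists_hamiltonianField_eq_generator A F (-ξ)
  refine ⟨fun ψ => α ψ, fun t => compEndOf c φ (exp (t • D)), smoothOn_dual _ _, ?_, by simp,
    fun t ht => ⟨hM t ht, fun β => ?_⟩⟩
  · ext
    simp [compEndOf, endOf]
  · rw [hα]
    have h1 : HasDerivAt (fun s : ℝ => exp (s • D)) (exp (t • D) * D) t :=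
      hasDerivAt_exp_smul_const D t
    have h2 := (LinearMap.toContinuousLinearMap (β ∘ₗ compEndOf c φ)).hasFDerivAt.comp_hasDerivAt
      t h1
    have h3 : generator (-ξ) (compEndOf c φ (exp (t • D))) =
        compEndOf c φ (exp (t • D) * D) := by
      rw [generator, map_neg, LinearMap.comp_neg, neg_neg, ← hD]
      ext
      simp [compEndOf, endOf]
    rw [h3]
    exact h2.hasDerivWithinAt

theorem isOpen_preimage_of_isOpenSet {W X : Type*} [AddCommGroup W] [Module ℝ W]
    [Module.Finite ℝ W] [NormedAddCommGroup X] [NormedSpace ℝ X] [FiniteDimensional ℝ X]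
    {U : Set W} (hU : IsOpenSet U) (L : X →ₗ[ℝ] W) : IsOpen (L ⁻¹' U) := by
  have h : L ⁻¹' U = (coord W ∘ₗ L : X →ₗ[ℝ] _) ⁻¹' ((coord W).symm ⁻¹' U) := by
    ext y
    simp
  rw [h]
  exact hU.preimage (LinearMap.continuous_of_finiteDimensional _)

/-- The orbit of `φ` under automorphisms close to the identity is contained in its leaf. -/
theorem eventually_hamiltonianStep_automorphism (A : (Fin 3 → 𝔤) → LinearMap.BilinForm ℝ 𝔤)
    (F : OrthonormalBasis (Fin 3) ℝ V) (c : 𝔤 ≃ₗ[ℝ] E) {U : Set (Fin 3 → 𝔤)} (hU : IsOpenSet U)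
    {φ : 𝔤 →ₗ[ℝ] V} (hφ : frameIdent F φ ∈ U) :
    ∀ᶠ S : E →L[ℝ] E in 𝓝 1,
      (∀ ξ η, endOf c S ⁅ξ, η⁆ = ⁅endOf c S ξ, endOf c S η⁆) →
        HamiltonianStep (frameTensor A F) {ψ | frameIdent F ψ ∈ U} φ (φ ∘ₗ endOf c S) := by
  have : CompleteSpace E := FiniteDimensional.complete ℝ E
  let L : (E →L[ℝ] E) →ₗ[ℝ] (Fin 3 → 𝔤) := (frameIdent F).toLinearMap ∘ₗ compEndOf c φ
  have hL : L ⁻¹' U ∈ 𝓝 (exp (0 : E →L[ℝ] E)) := by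
    refine (isOpen_preimage_of_isOpenSet hU L).mem_nhds ?_
    have : compEndOf c φ (exp 0) = φ := by
      ext
      simp [compEndOf, endOf]
    rw [Set.mem_preimage]
    change frameIdent F (compEndOf c φ (exp 0)) ∈ U
    rwa [this]
  have hexp : Tendsto (fun D : E →L[ℝ] E => exp D) (𝓝 0) (𝓝 (exp 0)) := by
    let _ : NormedAlgebra ℚ (E →L[ℝ] E) := .restrictScalars ℚ ℝ _
    exact (exp_continuous (𝔸 := E →L[ℝ] E)).tendsto 0
  -- A ball is chosen because it contains `t • D` for all `t ∈ [0, 1]` along with `D`, so the whole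
  -- curve stays in the domain.
  obtain ⟨r, hr, hball⟩ := Metric.mem_nhds_iff.1 (hexp hL)
  filter_upwards [eventually_automorphism_eq_exp_ad c (Metric.ball_mem_nhds 0 hr)] with S hS hSa
  obtain ⟨D, hDr, ξ, hD, rfl⟩ := hS hSa
  refine hamiltonianStep_exp_ad A F c hD φ fun t ht => hball ?_
  rw [mem_ball_zero_iff] at hDr ⊢
  rw [norm_smul, Real.norm_of_nonneg ht.1]
  exact (mul_le_of_le_one_left (norm_nonneg _) ht.2).trans_lt hDr

end Flow


/-! ### Equivariance of the tensors under Lie algebra automorphisms. -/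

section Automorphisms

variable {𝔤 : Type*} [LieRing 𝔤] [LieAlgebra ℝ 𝔤] [Module.Finite ℝ 𝔤] [LieAlgebra.IsKilling ℝ 𝔤]
  {V : Type*} [NormedAddCommGroup V] [InnerProductSpace ℝ V]

theorem killingForm_symm_apply {𝔤 : Type*} [LieRing 𝔤] [LieAlgebra ℝ 𝔤] (e : 𝔤 ≃ₗ⁅ℝ⁆ 𝔤)
    (ξ η : 𝔤) : killingForm ℝ 𝔤 (e.symm ξ) η = killingForm ℝ 𝔤 ξ (e η) := by
  rw [← LieAlgebra.killingForm_of_equiv_apply e, LieEquiv.apply_symm_apply]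

/-- The action of automorphisms of `𝔤` on `L(𝔤, V)`. -/
def autAct (V : Type*) [AddCommGroup V] [Module ℝ V] (e : 𝔤 ≃ₗ⁅ℝ⁆ 𝔤) :
    (𝔤 →ₗ[ℝ] V) ≃ₗ[ℝ] (𝔤 →ₗ[ℝ] V) :=
  e.toLinearEquiv.congrLeft V ℝ

theorem killingForm_frameIdent (F : OrthonormalBasis (Fin 3) ℝ V) (φ : 𝔤 →ₗ[ℝ] V) (i : Fin 3)
    (η : 𝔤) : killingForm ℝ 𝔤 (frameIdent F φ i) η = inner ℝ (F i) (φ η) := by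
  have : killingDual 𝔤 (frameIdent F φ i) = (innerₛₗ ℝ (F i)) ∘ₗ φ := by
    simp [frameIdent]
  exact LinearMap.congr_fun this η

/-- Automorphisms preserve the Killing form, so the coadjoint action becomes the adjoint one under
`𝔤^* ≃ 𝔤`. -/
theorem frameIdent_autAct (F : OrthonormalBasis (Fin 3) ℝ V) (e : 𝔤 ≃ₗ⁅ℝ⁆ 𝔤) (φ : 𝔤 →ₗ[ℝ] V) :
    frameIdent F (autAct V e φ) = fun i => e (frameIdent F φ i) := by
  ext i
  refine eq_of_forall_killingForm fun η => ?_
  rw [killingForm_frameIdent, show autAct V e φ η = φ (e.symm η) from rfl,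
    ← killingForm_frameIdent, killingForm_comm,
    killingForm_symm_apply, killingForm_comm]

theorem frameComp_dualMap_autAct (F : OrthonormalBasis (Fin 3) ℝ V) (e : 𝔤 ≃ₗ⁅ℝ⁆ 𝔤)
    (α : Module.Dual ℝ (𝔤 →ₗ[ℝ] V)) (i : Fin 3) :
    frameComp F i ((autAct V e).dualMap α) = e.symm (frameComp F i α) := by
  refine eq_of_forall_killingForm fun η => ?_
  have h : ∀ (α : Module.Dual ℝ (𝔤 →ₗ[ℝ] V)) η, killingForm ℝ 𝔤 (frameComp F i α) η =
      α ((frameIdent F).symm (Pi.single i η)) := by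
    intro α η
    rw [apply_eq_sum_frameComp F, Finset.sum_eq_single i]
    · simp
    · intro j _ hj
      simp [hj]
    · simp
  rw [killingForm_symm_apply, h, h, LinearEquiv.dualMap_apply]
  congr 1
  apply (frameIdent F).injective
  rw [frameIdent_autAct]
  ext j
  by_cases hj : j = i
  · subst hj; simp
  · simp [hj]

theorem frameTensor_eq_sum (A : (Fin 3 → 𝔤) → LinearMap.BilinForm ℝ 𝔤)
    (F : OrthonormalBasis (Fin 3) ℝ V) (φ : 𝔤 →ₗ[ℝ] V) (α β : Module.Dual ℝ (𝔤 →ₗ[ℝ] V)) :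
    frameTensor A F φ α β = ∑ i, ∑ j,
      bracketTable (A (frameIdent F φ)) (frameIdent F φ) i j
        (frameComp F i α) (frameComp F j β) := by
  simp only [frameTensor, tensor, LinearMap.compl₁₂_apply, LinearMap.sum_apply]
  rfl

/-- The tensors `π_F` are equivariant under the automorphisms of `𝔤` for which `A` is. -/
theorem frameTensor_autAct {A : (Fin 3 → 𝔤) → LinearMap.BilinForm ℝ 𝔤}
    {F : OrthonormalBasis (Fin 3) ℝ V} {e : 𝔤 ≃ₗ⁅ℝ⁆ 𝔤} {φ : 𝔤 →ₗ[ℝ] V}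
    (hA : ∀ ξ η, A (fun i => e (frameIdent F φ i)) (e ξ) (e η) = A (frameIdent F φ) ξ η)
    (α β : Module.Dual ℝ (𝔤 →ₗ[ℝ] V)) :
    frameTensor A F (autAct V e φ) α β =
      frameTensor A F φ ((autAct V e).dualMap α) ((autAct V e).dualMap β) := by
  have hl : ∀ c ξ η : 𝔤, lieForm (e c) ξ η = lieForm c (e.symm ξ) (e.symm η) := by
    intro c ξ η
    change killingForm ℝ 𝔤 ⁅ξ, η⁆ (e c) = killingForm ℝ 𝔤 ⁅e.symm ξ, e.symm η⁆ c
    rw [← LieEquiv.map_lie, killingForm_symm_apply]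
  have hA' : ∀ ξ η, A (fun i => e (frameIdent F φ i)) ξ η =
      A (frameIdent F φ) (e.symm ξ) (e.symm η) := by
    intro ξ η
    rw [← hA, LieEquiv.apply_symm_apply, LieEquiv.apply_symm_apply]
  simp only [frameTensor_eq_sum, frameComp_dualMap_autAct, frameIdent_autAct]
  refine Finset.sum_congr rfl fun i _ => Finset.sum_congr rfl fun j _ => ?_
  fin_cases i <;> fin_cases j <;> simp [bracketTable, hl, hA']

end Automorphisms

/-! ### The adjoint representation of `G`. -/

section Adjoint

open Filter Topology VectorField

variable {n : ℕ} {G : Type*} [TopologicalSpace G] [ChartedSpace (EuclideanSpace ℝ (Fin n)) G]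
  [Group G]

theorem Ad_one : Ad (n := n) (1 : G) = LinearMap.id := by
  have h2 : (fun h : G => 1 * h * 1⁻¹) = id := by
    ext x
    simp
  have h1 : HasMFDerivAt (𝓡 n) (𝓡 n) (fun h : G => 1 * h * 1⁻¹) 1
      (ContinuousLinearMap.id ℝ (EuclideanSpace ℝ (Fin n))) := by
    rw [h2]
    exact hasMFDerivAt_id 1
  ext v
  exact congrArg (fun S : EuclideanSpace ℝ (Fin n) →L[ℝ] EuclideanSpace ℝ (Fin n) => S v)
    h1.mfderiv

variable [LieGroup (𝓡 n) ∞ G]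

variable (n) in
theorem contMDiff_conj (k : G) : ContMDiff (𝓡 n) (𝓡 n) ∞ (fun h : G => k * h * k⁻¹) :=
  (contMDiff_const.mul contMDiff_id).mul contMDiff_const

variable (n) in
theorem hasMFDerivAt_conj (k h : G) : HasMFDerivAt (𝓡 n) (𝓡 n) (fun h : G => k * h * k⁻¹) h
    (mfderiv (𝓡 n) (𝓡 n) (fun h : G => k * h * k⁻¹) h) :=
  ((contMDiff_conj n k).mdifferentiable (by simp) h).hasMFDerivAt

theorem mfderiv_conj_inv_comp (k h : G) :
    (mfderiv (𝓡 n) (𝓡 n) (fun h : G => k⁻¹ * h * k⁻¹⁻¹) (k * h * k⁻¹)).comp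
      (mfderiv (𝓡 n) (𝓡 n) (fun h : G => k * h * k⁻¹) h) =
        ContinuousLinearMap.id ℝ (EuclideanSpace ℝ (Fin n)) := by
  have h1 := (hasMFDerivAt_conj n k⁻¹ (k * h * k⁻¹)).comp h (hasMFDerivAt_conj n k h)
  have h2 : (fun h : G => k⁻¹ * h * k⁻¹⁻¹) ∘ (fun h : G => k * h * k⁻¹) = id := by
    ext x
    simp [mul_assoc]
  rw [h2] at h1
  exact h1.mfderiv.symm.trans (mfderiv_id)

theorem Ad_mul (k l : G) : Ad (n := n) (k * l) = Ad k ∘ₗ Ad l := by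
  -- The point `l * 1 * l⁻¹` is `1` only propositionally, so the derivative at `1` is restated at a
  -- variable point, in the model space.
  have hk : ∀ y : G, y = 1 → HasMFDerivAt (𝓡 n) (𝓡 n) (fun h : G => k * h * k⁻¹) y
      (show EuclideanSpace ℝ (Fin n) →L[ℝ] EuclideanSpace ℝ (Fin n) from
        mfderiv (𝓡 n) (𝓡 n) (fun h : G => k * h * k⁻¹) 1) := by
    rintro _ rfl
    exact hasMFDerivAt_conj n k 1
  have h1 := (hk (l * 1 * l⁻¹) (by simp)).comp 1 (hasMFDerivAt_conj n l 1)
  have h2 : (fun h : G => k * h * k⁻¹) ∘ (fun h : G => l * h * l⁻¹) =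
      fun h : G => (k * l) * h * (k * l)⁻¹ := by
    ext x
    simp [mul_assoc]
  rw [h2] at h1
  ext v
  exact congrArg (fun S : EuclideanSpace ℝ (Fin n) →L[ℝ] EuclideanSpace ℝ (Fin n) => S v)
    h1.mfderiv

theorem isInvertible_mfderiv_conj (k h : G) :
    (mfderiv (𝓡 n) (𝓡 n) (fun h : G => k * h * k⁻¹) h).IsInvertible := by
  have h1 := mfderiv_conj_inv_comp (n := n) k h
  refine ContinuousLinearMap.IsInvertible.of_inverse
    (g := mfderiv (𝓡 n) (𝓡 n) (fun h : G => k⁻¹ * h * k⁻¹⁻¹) (k * h * k⁻¹)) ?_ h1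
  have h2 := (LinearMap.comp_eq_id_comm ℝ (EuclideanSpace ℝ (Fin n))).1 (congrArg
    (fun S : EuclideanSpace ℝ (Fin n) →L[ℝ] EuclideanSpace ℝ (Fin n) => S.toLinearMap) h1)
  ext1 v
  exact LinearMap.congr_fun h2 v

/-- Differentiate at `1` the identity `c_k ∘ L_h = L_{c_k(h)} ∘ c_k` between conjugation and left
translations. -/
theorem mfderiv_conj_mulInvariantVectorField (k h : G) (v : GroupLieAlgebra (𝓡 n) G) :
    mfderiv (𝓡 n) (𝓡 n) (fun h : G => k * h * k⁻¹) h (mulInvariantVectorField v h) =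
      mulInvariantVectorField (I := 𝓡 n) (Ad k v : GroupLieAlgebra (𝓡 n) G) (k * h * k⁻¹) := by
  have hL : ∀ g y : G, HasMFDerivAt (𝓡 n) (𝓡 n) (g * ·) y
      (mfderiv (𝓡 n) (𝓡 n) (g * ·) y) := fun g y =>
    ((contMDiff_mul_left (n := ∞)).mdifferentiable (by simp) y).hasMFDerivAt
  have hk : ∀ y : G, y = h → HasMFDerivAt (𝓡 n) (𝓡 n) (fun h : G => k * h * k⁻¹) y
      (show EuclideanSpace ℝ (Fin n) →L[ℝ] EuclideanSpace ℝ (Fin n) from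
        mfderiv (𝓡 n) (𝓡 n) (fun h : G => k * h * k⁻¹) h) := by
    rintro _ rfl
    exact hasMFDerivAt_conj n k _
  have hl : ∀ y : G, y = 1 → HasMFDerivAt (𝓡 n) (𝓡 n) ((k * h * k⁻¹) * ·) y
      (show EuclideanSpace ℝ (Fin n) →L[ℝ] EuclideanSpace ℝ (Fin n) from
        mfderiv (𝓡 n) (𝓡 n) ((k * h * k⁻¹) * ·) 1) := by
    rintro _ rfl
    exact hL _ _
  have h1 := (hk (h * 1) (mul_one h)).comp 1 (hL h 1)
  have h2 := (hl (k * 1 * k⁻¹) (by simp)).comp 1 (hasMFDerivAt_conj n k 1)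
  have h3 : (fun h : G => k * h * k⁻¹) ∘ (h * ·) =
      ((k * h * k⁻¹) * ·) ∘ (fun h : G => k * h * k⁻¹) := by
    ext x
    simp [mul_assoc]
  rw [h3] at h1
  exact congrArg (fun S : EuclideanSpace ℝ (Fin n) →L[ℝ] EuclideanSpace ℝ (Fin n) => S v)
    (hasMFDerivAt_unique h1 h2)

theorem mpullback_conj_mulInvariantVectorField (k : G) (v : GroupLieAlgebra (𝓡 n) G) :
    mpullback (𝓡 n) (𝓡 n) (fun h : G => k * h * k⁻¹)
      (mulInvariantVectorField (Ad k v : GroupLieAlgebra (𝓡 n) G)) =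
        mulInvariantVectorField (I := 𝓡 n) v := by
  ext1 h
  rw [mpullback_apply, (isInvertible_mfderiv_conj k h).inverse_apply_eq,
    mfderiv_conj_mulInvariantVectorField]

/-- Pull-back by conjugation commutes with brackets of vector fields and maps left-invariant fields
to left-invariant fields; evaluate at `1`. -/
theorem Ad_lie (k : G) (v w : GroupLieAlgebra (𝓡 n) G) : Ad k ⁅v, w⁆ = ⁅Ad k v, Ad k w⁆ := by
  have h := mpullback_mlieBracket (I := 𝓡 n) (I' := 𝓡 n) (n := minSmoothness ℝ 3) (x₀ := (1 : G))
    (f := fun h : G => k * h * k⁻¹)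
    (mdifferentiableAt_mulInvariantVectorField (Ad k v : GroupLieAlgebra (𝓡 n) G))
    (mdifferentiableAt_mulInvariantVectorField (Ad k w : GroupLieAlgebra (𝓡 n) G))
    (((contMDiff_conj n k).of_le
      (by simpa using ENat.LEInfty.out (m := (3 : WithTop ℕ∞)))) 1)
    (minSmoothness_monotone (by norm_cast))
  rw [mpullback_conj_mulInvariantVectorField, mpullback_conj_mulInvariantVectorField,
    mpullback_apply, (isInvertible_mfderiv_conj k 1).inverse_apply_eq] at h
  have e : ∀ y : G, y = 1 → (show EuclideanSpace ℝ (Fin n) from mlieBracket (𝓡 n)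
      (mulInvariantVectorField (I := 𝓡 n) (Ad k v : GroupLieAlgebra (𝓡 n) G))
      (mulInvariantVectorField (I := 𝓡 n) (Ad k w : GroupLieAlgebra (𝓡 n) G)) y) =
        (⁅Ad k v, Ad k w⁆ : GroupLieAlgebra (𝓡 n) G) := by
    rintro _ rfl
    rfl
  exact h.symm.trans (e _ (by simp))

theorem tendsto_Ad_one :
    Tendsto (fun k : G => (show EuclideanSpace ℝ (Fin n) →L[ℝ] EuclideanSpace ℝ (Fin n) from
      mfderiv (𝓡 n) (𝓡 n) (fun h : G => k * h * k⁻¹) 1)) (𝓝 1) (𝓝 1) := by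
  have hc : ContMDiffAt ((𝓡 n).prod (𝓡 n)) (𝓡 n) 1
      (Function.uncurry fun k h : G => k * h * k⁻¹) ((1 : G), (1 : G)) := by
    have : ContMDiff ((𝓡 n).prod (𝓡 n)) (𝓡 n) ∞
        (Function.uncurry fun k h : G => k * h * k⁻¹) :=
      (contMDiff_fst.mul contMDiff_snd).mul contMDiff_fst.inv
    exact (this.of_le (by simp)) _
  have h := (ContMDiffAt.mfderiv (m := 0) (fun k h : G => k * h * k⁻¹) (fun _ => 1) hc
    contMDiffAt_const (by simp)).continuousAt
  let ϕ : G → EuclideanSpace ℝ (Fin n) →L[ℝ] EuclideanSpace ℝ (Fin n) := fun k =>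
    mfderiv (𝓡 n) (𝓡 n) (fun h : G => k * h * k⁻¹) 1
  -- Source and target points are constantly `1`, so the coordinate changes are trivial and the
  -- continuity obtained is that of `Ad`.
  have e : inTangentCoordinates (𝓡 n) (𝓡 n) (fun _ : G => (1 : G))
      (fun k : G => k * 1 * k⁻¹) ϕ 1 = ϕ := by
    have e1 : (fun k : G => k * 1 * k⁻¹) = fun _ => 1 := by
      ext k
      simp
    rw [e1]
    ext1 k
    rw [inTangentCoordinates_eq (x₀ := (1 : G)) (x := k) (fun _ : G => (1 : G)) (fun _ => 1) ϕ
      (mem_chart_source _ _) (mem_chart_source _ _)]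
    ext1 v
    simp only [ContinuousLinearMap.comp_apply]
    erw [(tangentBundleCore (𝓡 n) G).coordChange_self _ _ (mem_achart_source _ _),
      (tangentBundleCore (𝓡 n) G).coordChange_self _ _ (mem_achart_source _ _)]
  have h' : ContinuousAt ϕ 1 := by
    rw [← e]
    exact h
  have h1 : ϕ 1 = 1 := by
    ext1 v
    exact LinearMap.congr_fun (Ad_one (n := n) (G := G)) v
  have := h'.tendsto
  rwa [h1] at this

/-- The adjoint action of `k`, as an automorphism of the Lie algebra. -/
noncomputable def adEquiv (k : G) : GroupLieAlgebra (𝓡 n) G ≃ₗ⁅ℝ⁆ GroupLieAlgebra (𝓡 n) G :=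
  { toLinearMap := Ad k
    map_lie' := Ad_lie k _ _
    invFun := Ad k⁻¹
    left_inv := fun v => by
      have := LinearMap.congr_fun (Ad_mul (n := n) k⁻¹ k) v
      rw [inv_mul_cancel, Ad_one] at this
      exact this.symm
    right_inv := fun v => by
      have := LinearMap.congr_fun (Ad_mul (n := n) k k⁻¹) v
      rw [mul_inv_cancel, Ad_one] at this
      exact this.symm }

end Adjoint

/-! ### The action of `G` on leaves. -/

section GroupAction

open Filter Topology

variable {n : ℕ} {G : Type*} [TopologicalSpace G] [ChartedSpace (EuclideanSpace ℝ (Fin n)) G]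
  [Group G]
  {V : Type*} [NormedAddCommGroup V] [InnerProductSpace ℝ V]

theorem actM_one (φ : GroupLieAlgebra (𝓡 n) G →ₗ[ℝ] V) : actM (1 : G) φ = φ := by
  rw [actM, inv_one, Ad_one]
  rfl

variable [LieGroup (𝓡 n) ∞ G]

theorem autAct_adEquiv_apply (k : G) (φ : GroupLieAlgebra (𝓡 n) G →ₗ[ℝ] V) :
    autAct V (adEquiv k) φ = actM k φ := rfl

theorem actM_mul (k l : G) (φ : GroupLieAlgebra (𝓡 n) G →ₗ[ℝ] V) :
    actM (k * l) φ = actM k (actM l φ) := by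
  rw [actM, mul_inv_rev, Ad_mul]
  rfl

theorem autAct_adEquiv_symm_apply (k : G) (φ : GroupLieAlgebra (𝓡 n) G →ₗ[ℝ] V) :
    (autAct V (adEquiv k)).symm φ = actM k⁻¹ φ := by
  rw [LinearEquiv.symm_apply_eq, autAct_adEquiv_apply, ← actM_mul, mul_inv_cancel, actM_one]

/-- The subgroup of `G` that preserves a set. -/
def setStabilizer (S : Set (GroupLieAlgebra (𝓡 n) G →ₗ[ℝ] V)) : Subgroup G where
  carrier := {k | actM k '' S = S}
  mul_mem' {k l} hk hl := by
    have h : actM (V := V) (n := n) (k * l) = actM k ∘ actM l := funext (actM_mul k l)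
    change actM (k * l) '' S = S
    rw [h, Set.image_comp, show actM l '' S = S from hl, show actM k '' S = S from hk]
  one_mem' := by
    change actM 1 '' S = S
    rw [show actM (V := V) (n := n) (1 : G) = id from funext actM_one, Set.image_id]
  inv_mem' {k} hk := by
    change actM k⁻¹ '' S = S
    nth_rw 1 [← show actM k '' S = S from hk]
    have h : actM (V := V) (n := n) k⁻¹ ∘ actM k = id := by
      ext1 φ
      rw [Function.comp_apply, ← actM_mul, inv_mul_cancel, actM_one]
      rfl
    rw [← Set.image_comp, h, Set.image_id]

variable [LieAlgebra.IsKilling ℝ (GroupLieAlgebra (𝓡 n) G)]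

theorem frameIdent_actM (F : OrthonormalBasis (Fin 3) ℝ V) (k : G)
    (φ : GroupLieAlgebra (𝓡 n) G →ₗ[ℝ] V) :
    frameIdent F (actM k φ) = diagAd k (frameIdent F φ) :=
  frameIdent_autAct F (adEquiv k) φ

variable {A : (Fin 3 → GroupLieAlgebra (𝓡 n) G) → LinearMap.BilinForm ℝ (GroupLieAlgebra (𝓡 n) G)}
  {U : Set (Fin 3 → GroupLieAlgebra (𝓡 n) G)}

theorem frameTensor_actM (hAG : ∀ k : G, ∀ x ∈ U, ∀ ξ η, A (diagAd k x) (Ad k ξ) (Ad k η) = A x ξ η)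
    {F : OrthonormalBasis (Fin 3) ℝ V} {φ : GroupLieAlgebra (𝓡 n) G →ₗ[ℝ] V}
    (hφ : frameIdent F φ ∈ U) (k : G) (α β : Module.Dual ℝ (GroupLieAlgebra (𝓡 n) G →ₗ[ℝ] V)) :
    frameTensor A F (actM k φ) α β = frameTensor A F φ ((autAct V (adEquiv k)).dualMap α)
      ((autAct V (adEquiv k)).dualMap β) :=
  frameTensor_autAct (e := adEquiv k) (hAG k _ hφ) α β

variable [FiniteDimensional ℝ V]

theorem image_actM_leafThrough (hUG : ∀ k : G, ∀ x ∈ U, diagAd k x ∈ U)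
    (hAG : ∀ k : G, ∀ x ∈ U, ∀ ξ η, A (diagAd k x) (Ad k ξ) (Ad k η) = A x ξ η)
    (F : OrthonormalBasis (Fin 3) ℝ V) (φ : GroupLieAlgebra (𝓡 n) G →ₗ[ℝ] V) (k : G) :
    actM k '' leafThrough (frameTensor A F) {ψ | frameIdent F ψ ∈ U} φ =
      leafThrough (frameTensor A F) {ψ | frameIdent F ψ ∈ U} (actM k φ) := by
  have hK : ∀ (k : G), ∀ ψ : GroupLieAlgebra (𝓡 n) G →ₗ[ℝ] V, frameIdent F ψ ∈ U →
      frameIdent F (actM k ψ) ∈ U := by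
    intro k ψ hψ
    rw [frameIdent_actM]
    exact hUG k _ hψ
  refine image_leafThrough (K := autAct V (adEquiv k)) (fun ψ hψ => hK k ψ hψ) (fun ψ hψ => ?_)
    (fun ψ hψ => frameTensor_actM hAG hψ k) φ
  rw [autAct_adEquiv_symm_apply]
  exact hK k⁻¹ ψ hψ

/-- Elements of `G` close to the identity move a point within its leaf. -/
theorem eventually_actM_mem_leafThrough
    (A : (Fin 3 → GroupLieAlgebra (𝓡 n) G) → LinearMap.BilinForm ℝ (GroupLieAlgebra (𝓡 n) G))
    (F : OrthonormalBasis (Fin 3) ℝ V) (hU : IsOpenSet U)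
    {φ : GroupLieAlgebra (𝓡 n) G →ₗ[ℝ] V} (hφ : frameIdent F φ ∈ U) :
    ∀ᶠ k : G in 𝓝 1, actM k φ ∈ leafThrough (frameTensor A F) {ψ | frameIdent F ψ ∈ U} φ := by
  have : IsTopologicalGroup G := topologicalGroup_of_lieGroup (𝓡 n) ∞
  let c : GroupLieAlgebra (𝓡 n) G ≃ₗ[ℝ] EuclideanSpace ℝ (Fin n) :=
    LinearEquiv.refl ℝ (EuclideanSpace ℝ (Fin n))
  have h := eventually_hamiltonianStep_automorphism A F c hU hφ
  have hinv : Tendsto (fun k : G => k⁻¹) (𝓝 1) (𝓝 1) := by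
    have := (continuous_inv (G := G)).tendsto 1
    rwa [inv_one] at this
  filter_upwards [(tendsto_Ad_one.comp hinv).eventually h] with k hk
  exact Relation.ReflTransGen.single (hk (Ad_lie k⁻¹))

/-- The identity component preserves each leaf. -/
theorem image_actM_eq_of_mem_connectedComponent (hU : IsOpenSet U)
    (hUG : ∀ k : G, ∀ x ∈ U, diagAd k x ∈ U)
    (hAG : ∀ k : G, ∀ x ∈ U, ∀ ξ η, A (diagAd k x) (Ad k ξ) (Ad k η) = A x ξ η)
    {F : OrthonormalBasis (Fin 3) ℝ V} {S : Set (GroupLieAlgebra (𝓡 n) G →ₗ[ℝ] V)}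
    (hS : IsSymplecticLeaf (frameTensor A F) {φ | frameIdent F φ ∈ U} S) {k : G}
    (hk : k ∈ connectedComponent (1 : G)) : actM k '' S = S := by
  have : IsTopologicalGroup G := topologicalGroup_of_lieGroup (𝓡 n) ∞
  obtain ⟨φ, hφ, rfl⟩ := hS
  set S := leafThrough (frameTensor A F) {φ | frameIdent F φ ∈ U} φ with hS
  -- It suffices to follow the single point `φ`: the image of its leaf is the leaf through `l • φ`,
  -- equal to `S` once `l • φ ∈ S`.
  have hnhds : (setStabilizer S : Set G) ∈ 𝓝 (1 : G) := by
    filter_upwards [eventually_actM_mem_leafThrough A F hU hφ] with l hl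
    change actM l '' S = S
    rw [hS, image_actM_leafThrough hUG hAG, leafThrough_eq_of_mem hl]
  have hopen : IsOpen (setStabilizer S : Set G) := Subgroup.isOpen_of_mem_nhds _ hnhds
  have hclopen : IsClopen (setStabilizer S : Set G) :=
    ⟨Subgroup.isClosed_of_isOpen _ hopen, hopen⟩
  exact hclopen.connectedComponent_subset (one_mem (setStabilizer S)) hk

end GroupAction

end HyperLiePoisson

theorem theorem3
    {n : ℕ} {G : Type*} [TopologicalSpace G] [ChartedSpace (EuclideanSpace ℝ (Fin n)) G] [Group G]
    [LieGroup (𝓡 n) ∞ G] [T2Space G] [CompactSpace G]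
    [LieAlgebra.IsSemisimple ℝ (GroupLieAlgebra (𝓡 n) G)]
    {V : Type*} [NormedAddCommGroup V] [InnerProductSpace ℝ V] [FiniteDimensional ℝ V]
    -- an open subset of `𝔤 × 𝔤 × 𝔤`, invariant under `G` and `SO(3)`
    (U : Set (Fin 3 → GroupLieAlgebra (𝓡 n) G))
    (hU : IsOpenSet U)
    (hUG : ∀ k : G, ∀ x ∈ U, diagAd k x ∈ U)
    (hUSO : ∀ O ∈ Matrix.specialOrthogonalGroup (Fin 3) ℝ, ∀ x ∈ U, rotate O x ∈ U)
    -- a smooth `SO(3)`-invariant function `A` on `U` with values in symmetric bilinear forms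
    (A : (Fin 3 → GroupLieAlgebra (𝓡 n) G) → LinearMap.BilinForm ℝ (GroupLieAlgebra (𝓡 n) G))
    (hAsmooth : ∀ ξ η, SmoothOn (fun x => A x ξ η) U)
    (hAsymm : ∀ x ∈ U, ∀ ξ η, A x ξ η = A x η ξ)
    (hASO : ∀ O ∈ Matrix.specialOrthogonalGroup (Fin 3) ℝ, ∀ x ∈ U, A (rotate O x) = A x)
    -- `A` is `G`-equivariant and satisfies the first order equations
    (hAG : ∀ k : G, ∀ x ∈ U, ∀ ξ η, A (diagAd k x) (Ad k ξ) (Ad k η) = A x ξ η)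
    (hAJ : ∀ x ∈ U, JacobiEquations A x)
    -- the linear system for `(u, v, w)` is solvable
    (hAS : ∀ x ∈ U, SystemSolvable (A x) x)
    -- a frame of `V`
    (F : OrthonormalBasis (Fin 3) ℝ V)
    -- a leaf `S` of the foliation of `M_U = {φ | Ψ_F φ ∈ U}`
    (S : Set (GroupLieAlgebra (𝓡 n) G →ₗ[ℝ] V))
    (hS : IsSymplecticLeaf (frameTensor A F) {φ | frameIdent F φ ∈ U} S) :
    -- at each point of `S` the pseudo-metric exists, is unique, symmetric and nondegenerate
    (∀ φ ∈ S, ∃! g : leafTangent (frameTensor A F φ) →ₗ[ℝ]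
        Module.Dual ℝ (leafTangent (frameTensor A F φ)),
      IsPseudoMetric (fun i => frameTensor A (cyclicFrame F i) φ)
        (leafTangent (frameTensor A F φ)) g) ∧
    (∀ φ ∈ S, ∀ g, IsPseudoMetric (fun i => frameTensor A (cyclicFrame F i) φ)
        (leafTangent (frameTensor A F φ)) g →
      (∀ v w, g v w = g w v) ∧ Function.Bijective g) ∧
    -- `G` permutes the leaves, and its identity component preserves each of them
    (∀ k : G, IsSymplecticLeaf (frameTensor A F) {φ | frameIdent F φ ∈ U} (actM k '' S)) ∧
    (∀ k ∈ connectedComponent (1 : G), actM k '' S = S) ∧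
    -- the action (which is linear on `M`) preserves the tangent spaces and the pseudo-metrics
    (∀ k : G, ∀ φ ∈ S,
      actM k '' (leafTangent (frameTensor A F φ) : Set (GroupLieAlgebra (𝓡 n) G →ₗ[ℝ] V)) =
        leafTangent (frameTensor A F (actM k φ)) ∧
      ∀ g g',
        IsPseudoMetric (fun i => frameTensor A (cyclicFrame F i) φ)
          (leafTangent (frameTensor A F φ)) g →
        IsPseudoMetric (fun i => frameTensor A (cyclicFrame F i) (actM k φ))
          (leafTangent (frameTensor A F (actM k φ))) g' →
        ∀ (v w : leafTangent (frameTensor A F φ)) (v' w' : leafTangent (frameTensor A F (actM k φ))),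
          (v' : GroupLieAlgebra (𝓡 n) G →ₗ[ℝ] V) = actM k (v : GroupLieAlgebra (𝓡 n) G →ₗ[ℝ] V) →
          (w' : GroupLieAlgebra (𝓡 n) G →ₗ[ℝ] V) = actM k (w : GroupLieAlgebra (𝓡 n) G →ₗ[ℝ] V) →
          g' v' w' = g v w) ∧
    -- `g(ξ̂, ξ̂) = -A_{ξ,ξ}`
    (∀ φ ∈ S, ∀ g, IsPseudoMetric (fun i => frameTensor A (cyclicFrame F i) φ)
        (leafTangent (frameTensor A F φ)) g →
      ∀ ξ, ∃ h : generator ξ φ ∈ leafTangent (frameTensor A F φ),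
        g ⟨generator ξ φ, h⟩ ⟨generator ξ φ, h⟩ = -A (frameIdent F φ) ξ ξ) := by
  have hSU : ∀ φ ∈ S, frameIdent F φ ∈ U := by
    obtain ⟨φ₀, hφ₀, rfl⟩ := hS
    exact fun φ hφ => mem_of_mem_leafThrough (D := {φ | frameIdent F φ ∈ U}) hφ₀ hφ
  -- Cyclic permutations are even, so passing to another frame is a rotation in `SO(3)`: all three
  -- tensors see the same `U` and the same value of `A`.
  have hcyc : ∀ φ : GroupLieAlgebra (𝓡 n) G →ₗ[ℝ] V, frameIdent F φ ∈ U → ∀ i,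
      frameIdent (cyclicFrame F i) φ ∈ U ∧
        A (frameIdent (cyclicFrame F i) φ) = A (frameIdent F φ) := by
    intro φ hφ i
    obtain ⟨O, hO, h⟩ := exists_rotate_eq_cyclic (𝔤 := GroupLieAlgebra (𝓡 n) G) i
    have e : frameIdent (cyclicFrame F i) φ = rotate O (frameIdent F φ) := by
      rw [h]
      exact funext fun j => frameIdent_cyclicFrame F i j φ
    rw [e]
    exact ⟨hUSO O hO _ hφ, hASO O hO _ hφ⟩
  have hskew : ∀ φ : GroupLieAlgebra (𝓡 n) G →ₗ[ℝ] V, frameIdent F φ ∈ U → ∀ i α β,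
      frameTensor A (cyclicFrame F i) φ α β = -frameTensor A (cyclicFrame F i) φ β α :=
    fun φ hφ i => frameTensor_skew (hAsymm _ (hcyc φ hφ i).1)
  refine ⟨fun φ hφ => ?_, fun φ hφ g hg => ⟨?_, hg.bijective⟩, fun k => ?_, fun k hk => ?_,
    fun k φ hφ => ⟨?_, fun g g' hg hg' v w v' w' hv hw => ?_⟩, fun φ hφ g hg ξ => ?_⟩
  · exact existsUnique_isPseudoMetric (hskew φ (hSU φ hφ))
      (leafTangent_cyclicFrame (fun i => (hcyc φ (hSU φ hφ) i).2) (hAS _ (hSU φ hφ)))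
  · exact isPseudoMetric_symm (hAsymm _ (hSU φ hφ)) (fun i => (hcyc φ (hSU φ hφ) i).2)
      (hAS _ (hSU φ hφ)) hg
  · obtain ⟨φ₀, hφ₀, rfl⟩ := hS
    refine ⟨actM k φ₀, ?_, image_actM_leafThrough hUG hAG F φ₀ k⟩
    change frameIdent F (actM k φ₀) ∈ U
    rw [frameIdent_actM]
    exact hUG k _ hφ₀
  · exact image_actM_eq_of_mem_connectedComponent hU hUG hAG hS hk
  · exact image_leafTangent (K := autAct V (adEquiv k)) (frameTensor_actM hAG (hSU φ hφ) k)
  · exact hg.map_apply hg' (K := autAct V (adEquiv k))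
      (fun i => frameTensor_actM hAG (hcyc φ (hSU φ hφ) i).1 k) hv hw
  · have h := generator_mem_leafTangent (fun i => (hcyc φ (hSU φ hφ) i).2) (hAS _ (hSU φ hφ)) ξ
    exact ⟨h, isPseudoMetric_generator (hAsymm _ (hSU φ hφ)) (fun i => (hcyc φ (hSU φ hφ) i).2)
      hg ξ h⟩
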